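/- **Conventions.** A ReLU MLP with $d$ inputs and one output is given by an integer $\Delta\ge 1$, dimensions $d_1=d$, $d_2,\dots,d_\Delta\ge 1$, $d_{\Delta+1}=1$, weight matrices $W^{(l)}\in\mathbb{R}^{d_{l+1}\times d_l}$ and bias vectors $b^{(l)}\in\mathbb{R}^{d_{l+1}}$, $l=1,\dots,\Delta$. It realises the function $\Phi:\mathbb{R}^d\to\mathbb{R}$, $\Phi(x)=W^{(\Delta)}x^{(\Delta)}+b^{(\Delta)}$, where $x^{(1)}=x$ and $x^{(l+1)}=\max\{W^{(l)}x^{(l)}+b^{(l)},0\}$ (componentwise) for $1\le l<\Delta$. Its width vector is $[d_2,\dots,d_\Delta]$, its depth is $\Delta-1$, its width is $\max_{2\le l\le\Delta}d_l$ (and $0$ if $\Delta=1$), and its number of nonzero parameters is the number of nonzero entries of all the $W^{(l)}$ and $b^{(l)}$. Let $\|x\|_1=\sum_i|x_i|$. For $L\ge 0$, $\alpha\in(0,1]$ and $\Omega\subseteq\mathbb{R}^d$, $\operatorname{Hol}(L,\alpha,\Omega)$ is the set of functions $g$ with $|g(x)-g(y)|\le L\|x-y\|_1^\alpha$ for all $x,y\in\Omega$.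 For $g:\mathbb{R}^d\to\mathbb{R}$, $\operatorname{Lip}(g)=\sup_{x\ne y}|g(x)-g(y)|/\|x-y\|_1$. **Theorem.** There is an absolute constant $C$ such that the following holds for all integers $d\ge1$ and $n\ge 2$, all $\nu\ge 0$ and $\alpha\in(0,1]$, and every $f\in\operatorname{Hol}(\nu,\alpha,[0,1]^d)$. 1. If $d=1$, there is a ReLU MLP $\Phi:\mathbb{R}\to\mathbb{R}$ with width vector $[2n+1,2n]$ and at most $Cn^2$ nonzero parameters such that $$\sup_{x\in[0,1]}|f(x)-\Phi(x)|\le\frac{\nu}{(2n^2)^\alpha}\qquad\text{and}\qquad \Phi\in\operatorname{Hol}(\nu,\alpha,[0,1]).$$ 2. If $d>1$, there is a ReLU MLP $\Phi:\mathbb{R}^d\to\mathbb{R}$ of width at most $\max\{(2n+3)d,\;6d+3,\;2\lceil(n+1)^{d/2}\rceil+2d\}$, depth at most $23d+9$, and with at most $C\,d\,n^d$ nonzero parameters, such that $$\sup_{x\in[0,1]^d}|f(x)-\Phi(x)|\le\nu\left(\frac{d^2}{n(2d+1)}\right)^{\alpha}\qquad\text{and}\qquad \operatorname{Lip}(\Phi)\le\nu\,(n+1)^d\,(2d+1)\,d^\alpha.$$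 -/

import Mathlib

/-- ReLU multilayer perceptrons with `a` inputs and `c` outputs, as finite lists of affine layers
(weight matrix and bias vector). `output W b` is the final affine map, without activation;
`hidden hb W b Φ` first applies the affine map and the componentwise ReLU, landing in a hidden
layer with a positive number of neurons, and then the remaining network `Φ`. -/
inductive ReLUMLP : ℕ → ℕ → Type
  | output {a c : ℕ} (W : Matrix (Fin c) (Fin a) ℝ) (bias : Fin c → ℝ) : ReLUMLP a c
  | hidden {a b c : ℕ} (hb : 0 < b) (W : Matrix (Fin b) (Fin a) ℝ) (bias : Fin b → ℝ)
      (Φ : ReLUMLP b c) : ReLUMLP a c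

namespace ReLUMLP

/-- The map `ℝᵃ → ℝᶜ` realised by the network. -/
noncomputable def eval : {a c : ℕ} → ReLUMLP a c → (Fin a → ℝ) → (Fin c → ℝ)
  | _, _, output W bias, x => W.mulVec x + bias
  | _, _, hidden _ W bias Φ, x => Φ.eval (fun i => max ((W.mulVec x + bias) i) 0)

/-- The real-valued function on `ℝᵈ` realised by a network with one output. -/
noncomputable def fn {d : ℕ} (Φ : ReLUMLP d 1) (x : Fin d → ℝ) : ℝ := Φ.eval x 0

/-- The numbers of neurons of the hidden layers, from the first to the last. -/
def widthvec : {a c : ℕ} → ReLUMLP a c → List ℕ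
  | _, _, output _ _ => []
  | _, _, hidden (b := b) _ _ _ Φ => b :: Φ.widthvec

/-- The number of hidden layers. -/
def depth {a c : ℕ} (Φ : ReLUMLP a c) : ℕ := Φ.widthvec.length

/-- The largest number of neurons in a hidden layer. -/
def width {a c : ℕ} (Φ : ReLUMLP a c) : ℕ := Φ.widthvec.foldr max 0

/-- The number of nonzero entries of a weight matrix and a bias vector. -/
noncomputable def layerParams {a b : ℕ} (W : Matrix (Fin b) (Fin a) ℝ) (bias : Fin b → ℝ) : ℕ :=
  (Finset.univ.filter fun p : Fin b × Fin a => W p.1 p.2 ≠ 0).card +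
    (Finset.univ.filter fun i : Fin b => bias i ≠ 0).card

/-- The number of nonzero parameters (weights and biases) of the network. -/
noncomputable def numParams : {a c : ℕ} → ReLUMLP a c → ℕ
  | _, _, output W bias => layerParams W bias
  | _, _, hidden _ W bias Φ => layerParams W bias + Φ.numParams

end ReLUMLP

/-- The `ℓ¹` norm on `ℝᵈ`. -/
def l1Norm {d : ℕ} (x : Fin d → ℝ) : ℝ := ∑ i, |x i|

/-- The unit cube `[0,1]ᵈ`. -/
def unitCube (d : ℕ) : Set (Fin d → ℝ) := Set.Icc 0 1

/-- The class of functions that are `α`-Hölder on `Ω` with constant `L`, with respect to the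
`ℓ¹` norm. Functions are represented by total functions; only their values on `Ω` matter. -/
def Hol {d : ℕ} (L α : ℝ) (Ω : Set (Fin d → ℝ)) : Set ((Fin d → ℝ) → ℝ) :=
  {f | ∀ x ∈ Ω, ∀ y ∈ Ω, |f x - f y| ≤ L * l1Norm (x - y) ^ α}

/-- The optimal Lipschitz constant, with respect to the `ℓ¹` norm, of a function on `ℝᵈ`
(possibly infinite). -/
noncomputable def optLip {d : ℕ} (g : (Fin d → ℝ) → ℝ) : ENNReal :=
  ⨆ (x : Fin d → ℝ) (y : Fin d → ℝ) (_ : x ≠ y), ENNReal.ofReal (|g x - g y| / l1Norm (x - y))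

/-! In one variable the network is the piecewise linear interpolant of `f` at the points `i / n ^
2`. By concavity of `t ^ α` it inherits the Hölder modulus (`interp_holder`), and at relative
position `θ` in a cell the mean distance to the two nodes is `2θ(1 - θ) ≤ 1/2` mesh, hence the
factor 2 in the error. About `4n` neurons produce `n ^ 2` pieces: the first layer has breakpoints
only at the first two nodes of each of `n` blocks, and one neuron of the second layer creates
nonnegative kinks at a fixed position of all blocks at once (`exists_max_add_eq_sum_hinge`).

In several variables the cube is cut into boxes, and `f` is replaced by its value at the centre of
the box. Continuous staircases in each coordinate, combined in mixed radix, give the index of the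
box, and the interpolation network looks up the value in a table. The index is wrong only when some
coordinate lies in a short gap where a staircase climbs. Therefore `2d + 1` shifted grids are used,
whose gaps in each coordinate are disjoint: every coordinate spoils at most one grid, at least `d +
1` grids are right, and the median of the `2d + 1` answers is right. The median is 1-Lipschitz in
the sup norm, so the Lipschitz bound is the oscillation `ν d ^ α` of the table times the Lipschitz
constant of the index. See `exists_mlp_shifted_grids`.

The grid is chosen to have `O(n ^ d)` boxes, as the parameter count requires. If `(n + 1) ^ d < 32 n
^ d`, a uniform grid works. Otherwise `d` is large compared with `n`; then `4 n ^ d` boxes suffice,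
the first coordinate being cut more finely to pay for the gaps, whose lengths grow geometrically
with the coordinate. -/

/-! ### Affine functions. -/

/-- A real function on `ι → ℝ` given by weights and a bias. -/
def IsAff {ι : Type} [Fintype ι] (g : (ι → ℝ) → ℝ) : Prop :=
  ∃ (w : ι → ℝ) (b : ℝ), ∀ x, g x = ∑ i, w i * x i + b

namespace IsAff

variable {ι : Type} [Fintype ι]

theorem const (b : ℝ) : IsAff (fun _ : ι → ℝ => b) := ⟨0, b, by simp⟩

theorem coord (i : ι) : IsAff (fun x : ι → ℝ => x i) := by
  classical
  exact ⟨Pi.single i 1, 0, by simp [Pi.single_apply]⟩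

theorem add {f g : (ι → ℝ) → ℝ} (hf : IsAff f) (hg : IsAff g) : IsAff (fun x => f x + g x) := by
  obtain ⟨w, b, h⟩ := hf
  obtain ⟨w', b', h'⟩ := hg
  refine ⟨w + w', b + b', fun x => ?_⟩
  simp only [h, h', Pi.add_apply, add_mul, Finset.sum_add_distrib]
  ring

theorem const_mul (c : ℝ) {f : (ι → ℝ) → ℝ} (hf : IsAff f) : IsAff (fun x => c * f x) := by
  obtain ⟨w, b, h⟩ := hf
  refine ⟨fun i => c * w i, c * b, fun x => ?_⟩
  simp only [h, mul_add, Finset.mul_sum, mul_assoc]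

theorem sub {f g : (ι → ℝ) → ℝ} (hf : IsAff f) (hg : IsAff g) : IsAff (fun x => f x - g x) := by
  simpa [sub_eq_add_neg] using hf.add (hg.const_mul (-1))

theorem sum {κ : Type} (s : Finset κ) {f : κ → (ι → ℝ) → ℝ} (hf : ∀ k, IsAff (f k)) :
    IsAff (fun x => ∑ k ∈ s, f k x) := by
  classical
  induction s using Finset.induction_on with
  | empty => simpa using const (ι := ι) 0
  | insert k s hk ih => simpa [Finset.sum_insert hk] using (hf k).add ih

end IsAff

/-! ### Composing networks from layers; crude parameter count. -/

namespace ReLUMLP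

theorem exists_hidden {d : ℕ} {κ : Type} [Fintype κ] [Nonempty κ]
    {L : κ → (Fin d → ℝ) → ℝ} (hL : ∀ k, IsAff (L k)) (Φ : ReLUMLP (Fintype.card κ) 1) :
    ∃ Ψ : ReLUMLP d 1, Ψ.widthvec = Fintype.card κ :: Φ.widthvec ∧
      ∀ x, Ψ.fn x = Φ.fn ((fun k => max (L k x) 0) ∘ (Fintype.equivFin κ).symm) := by
  choose w b h using hL
  refine ⟨hidden Fintype.card_pos (Matrix.of fun i => w ((Fintype.equivFin κ).symm i))
    (fun i => b ((Fintype.equivFin κ).symm i)) Φ, rfl, fun x => ?_⟩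
  simp only [fn, eval]
  congr 1
  funext i
  simp [h, Matrix.mulVec, dotProduct]

/-- The network `Φ` with hidden widths `ws` agrees with `G` on inputs with nonnegative entries. -/
def Realizes {ι : Type} [Fintype ι] (ws : List ℕ) (G : (ι → ℝ) → ℝ) : Prop :=
  ∃ Φ : ReLUMLP (Fintype.card ι) 1, Φ.widthvec = ws ∧
    ∀ x : ι → ℝ, (∀ i, 0 ≤ x i) → Φ.fn (x ∘ (Fintype.equivFin ι).symm) = G x

theorem Realizes.of_isAff {ι : Type} [Fintype ι] {G : (ι → ℝ) → ℝ} (hG : IsAff G) :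
    Realizes [] G := by
  obtain ⟨w, b, h⟩ := hG
  refine ⟨output (Matrix.of fun _ i => w ((Fintype.equivFin ι).symm i)) (fun _ => b), rfl,
    fun x _ => ?_⟩
  simp only [fn, eval, h, Pi.add_apply, Matrix.mulVec, dotProduct, Matrix.of_apply,
    Function.comp_apply]
  congr 1
  exact (Fintype.equivFin ι).symm.sum_comp (fun i => w i * x i)

theorem Realizes.exists_mlp {d : ℕ} {κ : Type} [Fintype κ] [Nonempty κ] {ws : List ℕ}
    {H : (κ → ℝ) → ℝ} (hH : Realizes ws H) {L : κ → (Fin d → ℝ) → ℝ} (hL : ∀ k, IsAff (L k)) :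
    ∃ Ψ : ReLUMLP d 1, Ψ.widthvec = Fintype.card κ :: ws ∧
      ∀ x, Ψ.fn x = H (fun k => max (L k x) 0) := by
  obtain ⟨Φ, hw, h⟩ := hH
  obtain ⟨Ψ, hw', h'⟩ := exists_hidden hL Φ
  exact ⟨Ψ, by rw [hw', hw], fun x => by rw [h', h _ fun _ => le_max_right _ _]⟩

/-- Networks are built backwards from the output by prepending layers. Testing only nonnegative
inputs makes ReLU the identity on stored values, so copying one costs a single neuron. -/
theorem Realizes.layer {ι κ : Type} [Fintype ι] [Fintype κ] [Nonempty κ] {ws : List ℕ}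
    {H : (κ → ℝ) → ℝ} (hH : Realizes ws H) {L : κ → (ι → ℝ) → ℝ} (hL : ∀ k, IsAff (L k))
    {G : (ι → ℝ) → ℝ} (hG : ∀ x, (∀ i, 0 ≤ x i) → G x = H (fun k => max (L k x) 0)) :
    Realizes (Fintype.card κ :: ws) G := by
  have hL' : ∀ k, IsAff (fun z : Fin (Fintype.card ι) → ℝ => L k (z ∘ Fintype.equivFin ι)) := by
    intro k
    obtain ⟨w, b, h⟩ := hL k
    refine ⟨w ∘ (Fintype.equivFin ι).symm, b, fun z => ?_⟩
    beta_reduce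
    rw [h, ← (Fintype.equivFin ι).symm.sum_comp]
    simp
  obtain ⟨Ψ, hw, h⟩ := hH.exists_mlp hL'
  refine ⟨Ψ, hw, fun x hx => ?_⟩
  rw [h, hG x hx]
  simp [Function.comp_assoc]

/-- Some network of width at most `w` and depth at most `D` agrees with `G` on inputs with
nonnegative entries. -/
def IsNet {ι : Type} [Fintype ι] (w D : ℕ) (G : (ι → ℝ) → ℝ) : Prop :=
  ∃ ws : List ℕ, (∀ v ∈ ws, v ≤ w) ∧ ws.length ≤ D ∧ Realizes ws G

theorem IsNet.of_isAff {ι : Type} [Fintype ι] (w : ℕ) {G : (ι → ℝ) → ℝ} (hG : IsAff G) :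
    IsNet w 0 G :=
  ⟨[], by simp, by simp, .of_isAff hG⟩

theorem IsNet.layer {ι κ : Type} [Fintype ι] [Fintype κ] [Nonempty κ] {w D : ℕ}
    {H : (κ → ℝ) → ℝ} (hH : IsNet w D H) (hκ : Fintype.card κ ≤ w)
    {L : κ → (ι → ℝ) → ℝ} (hL : ∀ k, IsAff (L k))
    {G : (ι → ℝ) → ℝ} (hG : ∀ x, (∀ i, 0 ≤ x i) → G x = H (fun k => max (L k x) 0)) :
    IsNet w (D + 1) G := by
  obtain ⟨ws, h1, h2, h3⟩ := hH
  exact ⟨_ :: ws, by simpa using ⟨hκ, h1⟩, by simpa using h2, h3.layer hL hG⟩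

theorem foldr_max_le {w : ℕ} {ws : List ℕ} (h : ∀ v ∈ ws, v ≤ w) : ws.foldr max 0 ≤ w := by
  induction ws with
  | nil => simp
  | cons a l ih => simp_all

theorem IsNet.exists_mlp {d : ℕ} {κ : Type} [Fintype κ] [Nonempty κ] {w D : ℕ}
    {H : (κ → ℝ) → ℝ} (hH : IsNet w D H) (hκ : Fintype.card κ ≤ w)
    {L : κ → (Fin d → ℝ) → ℝ} (hL : ∀ k, IsAff (L k)) :
    ∃ Ψ : ReLUMLP d 1, Ψ.width ≤ w ∧ Ψ.depth ≤ D + 1 ∧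
      ∀ x, Ψ.fn x = H (fun k => max (L k x) 0) := by
  obtain ⟨ws, h1, h2, h3⟩ := hH
  obtain ⟨Ψ, hw, h⟩ := h3.exists_mlp hL
  refine ⟨Ψ, ?_, ?_, h⟩
  · rw [width, hw]
    exact foldr_max_le (by simpa using ⟨hκ, h1⟩)
  · rw [depth, hw]
    simpa using h2

theorem layerParams_le {a b : ℕ} (W : Matrix (Fin b) (Fin a) ℝ) (bias : Fin b → ℝ) :
    layerParams W bias ≤ b * a + b := by
  unfold layerParams
  gcongr
  · exact (Finset.card_le_univ _).trans (by simp)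
  · exact (Finset.card_le_univ _).trans (by simp)

theorem numParams_le {a c w : ℕ} (Φ : ReLUMLP a c) (ha : a ≤ w) (hc : c ≤ w)
    (hw : Φ.width ≤ w) : Φ.numParams ≤ (Φ.depth + 1) * (w + 1) ^ 2 := by
  induction Φ with
  | @output a c W bias =>
    have h := layerParams_le W bias
    have h2 : c * a ≤ w * w := Nat.mul_le_mul hc ha
    simp only [numParams, depth, widthvec, List.length_nil]
    nlinarith
  | @hidden a b c hb W bias Φ ih =>
    simp only [width, widthvec, List.foldr_cons, max_le_iff] at hw
    have h := layerParams_le W bias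
    have h2 : b * a ≤ w * w := Nat.mul_le_mul hw.1 ha
    have h3 := ih hw.1 hc hw.2
    simp only [numParams, depth, widthvec, List.length_cons] at h3 ⊢
    nlinarith [hw.1]

end ReLUMLP

/-! ### Piecewise linear interpolation of Hölder data. -/

/-- The piecewise linear interpolation of the values `y i` at the points `i`. -/
noncomputable def interp (y : ℕ → ℝ) (t : ℝ) : ℝ :=
  (1 - (t - ⌊t⌋₊)) * y ⌊t⌋₊ + (t - ⌊t⌋₊) * y (⌊t⌋₊ + 1)

theorem interp_eq (y : ℕ → ℝ) {t : ℝ} (k : ℕ) (h0 : (k : ℝ) ≤ t) (h1 : t ≤ k + 1) :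
    interp y t = (1 - (t - k)) * y k + (t - k) * y (k + 1) := by
  have ht : 0 ≤ t := (Nat.cast_nonneg k).trans h0
  rcases h1.lt_or_eq with h | h
  · have : ⌊t⌋₊ = k := (Nat.floor_eq_iff ht).2 ⟨h0, h⟩
    rw [interp, this]
  · have : ⌊t⌋₊ = k + 1 := (Nat.floor_eq_iff ht).2 ⟨by push_cast; exact h.ge, by push_cast; linarith⟩
    rw [interp, this, h]
    push_cast
    ring

theorem interp_natCast (y : ℕ → ℝ) (k : ℕ) : interp y k = y k := by
  simp [interp]

theorem interp_nonneg {y : ℕ → ℝ} (hy : ∀ i, 0 ≤ y i) {t : ℝ} (ht : 0 ≤ t) : 0 ≤ interp y t := by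
  have h1 := Nat.floor_le ht
  have h2 := Nat.lt_floor_add_one t
  exact add_nonneg (mul_nonneg (by linarith) (hy _)) (mul_nonneg (by linarith) (hy _))

/-- Jensen's inequality for the concave function `t ^ α`. -/
theorem abs_convex_comb_sub_le {L α a b z θ u v : ℝ} (hL : 0 ≤ L) (hα : 0 ≤ α) (hα1 : α ≤ 1)
    (h0 : 0 ≤ θ) (h1 : θ ≤ 1) (hu : 0 ≤ u) (hv : 0 ≤ v)
    (ha : |a - z| ≤ L * u ^ α) (hb : |b - z| ≤ L * v ^ α) :
    |((1 - θ) * a + θ * b) - z| ≤ L * ((1 - θ) * u + θ * v) ^ α := by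
  have hc := (Real.concaveOn_rpow hα hα1).2 (Set.mem_Ici.2 hu) (Set.mem_Ici.2 hv)
    (sub_nonneg.2 h1) h0 (by ring)
  simp only [smul_eq_mul] at hc
  calc |((1 - θ) * a + θ * b) - z| = |(1 - θ) * (a - z) + θ * (b - z)| := by ring_nf
    _ ≤ |(1 - θ) * (a - z)| + |θ * (b - z)| := abs_add_le _ _
    _ = (1 - θ) * |a - z| + θ * |b - z| := by
        rw [abs_mul, abs_mul, abs_of_nonneg (sub_nonneg.2 h1), abs_of_nonneg h0]
    _ ≤ (1 - θ) * (L * u ^ α) + θ * (L * v ^ α) := by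
        gcongr
    _ = L * ((1 - θ) * u ^ α + θ * v ^ α) := by ring
    _ ≤ _ := by gcongr

/-- Interpolation of values on `{0, …, M}` preserves a Hölder modulus of continuity. -/
theorem interp_holder {y : ℕ → ℝ} {L α : ℝ} {M : ℕ} (hL : 0 ≤ L) (hα : 0 < α) (hα1 : α ≤ 1)
    (hy : ∀ i ≤ M, ∀ j ≤ M, |y i - y j| ≤ L * |(i : ℝ) - j| ^ α) {s t : ℝ}
    (hs : 0 ≤ s) (hst : s ≤ t) (ht : t ≤ M) :
    |interp y s - interp y t| ≤ L * (t - s) ^ α := by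
  rcases hst.eq_or_lt with rfl | hlt
  · simp [Real.zero_rpow hα.ne']
  have hi := Nat.floor_le hs
  have hi1 := Nat.lt_floor_add_one s
  set i := ⌊s⌋₊
  have ht0 : 0 < t := hs.trans_lt hlt
  obtain ⟨j, hj, hj1⟩ : ∃ j : ℕ, (j : ℝ) < t ∧ t ≤ j + 1 := by
    refine ⟨⌈t⌉₊ - 1, ?_, ?_⟩
    · have := Nat.ceil_lt_add_one ht0.le
      have h1 : 1 ≤ ⌈t⌉₊ := Nat.one_le_ceil_iff.2 ht0
      push_cast [h1]
      linarith
    · have := Nat.le_ceil t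
      have h1 : 1 ≤ ⌈t⌉₊ := Nat.one_le_ceil_iff.2 ht0
      push_cast [h1]
      linarith
  have hjM : j + 1 ≤ M := by
    have : (j : ℝ) < M := hj.trans_le ht
    exact_mod_cast this
  have hij : i ≤ j := by
    have : (i : ℝ) < j + 1 := by linarith
    exact Nat.lt_succ_iff.1 (by exact_mod_cast this)
  rw [interp_eq y i hi hi1.le, interp_eq y j hj.le hj1]
  -- Within one piece the interpolant is linear, and `t - s ≤ (t - s) ^ α` because `t - s ≤ 1`.
  -- Otherwise a node separates the points, and Jensen is applied first in `t`, against each fixed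
  -- node, and then in `s`.
  rcases hij.eq_or_lt with h | h
  · rw [← h] at hj hj1 hjM ⊢
    have h1 := hy i (by omega) (i + 1) hjM
    have h2 : |(i : ℝ) - (i + 1 : ℕ)| = 1 := by simp
    rw [h2, Real.one_rpow, mul_one] at h1
    have h3 : t - s ≤ (t - s) ^ α := by
      conv_lhs => rw [← Real.rpow_one (t - s)]
      exact Real.rpow_le_rpow_of_exponent_ge (by linarith) (by linarith) hα1
    calc _ = |(t - s) * (y i - y (i + 1))| := by ring_nf
      _ = (t - s) * |y i - y (i + 1)| := by rw [abs_mul, abs_of_pos (by linarith)]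
      _ ≤ (t - s) ^ α * L := by gcongr
      _ = _ := mul_comm _ _
  · have hij' : (i : ℝ) + 1 ≤ j := by exact_mod_cast h
    have key : ∀ a ≤ j, |((1 - (t - j)) * y j + (t - j) * y (j + 1)) - y a| ≤
        L * (t - a) ^ α := by
      intro a ha
      have ha' : (a : ℝ) ≤ j := by exact_mod_cast ha
      have e1 := hy j (by omega) a (by omega)
      have e2 := hy (j + 1) hjM a (by omega)
      rw [abs_of_nonneg (by linarith : (0 : ℝ) ≤ j - a)] at e1
      rw [abs_of_nonneg (by push_cast; linarith : (0 : ℝ) ≤ (j + 1 : ℕ) - a)] at e2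
      have := abs_convex_comb_sub_le hL hα.le hα1 (θ := t - j) (by linarith) (by linarith)
        (by linarith) (by push_cast; linarith) e1 e2
      convert this using 3
      push_cast
      ring_nf
    have e1 := key i (by omega)
    have e2 := key (i + 1) (by omega)
    rw [abs_sub_comm] at e1 e2
    have := abs_convex_comb_sub_le hL hα.le hα1 (θ := s - i) (by linarith) (by linarith)
      (by linarith) (by push_cast; linarith) e1 e2
    convert this using 3
    push_cast
    ring_nf

/-- Interpolating a Hölder function at two points at distance one. -/
theorem abs_interp_sub_le {y : ℕ → ℝ} {L α z t : ℝ} (hL : 0 ≤ L) (hα : 0 ≤ α) (hα1 : α ≤ 1)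
    (k : ℕ) (h0 : (k : ℝ) ≤ t) (h1 : t ≤ k + 1) (hk : |y k - z| ≤ L * (t - k) ^ α)
    (hk1 : |y (k + 1) - z| ≤ L * (k + 1 - t) ^ α) :
    |interp y t - z| ≤ L * (1 / 2) ^ α := by
  rw [interp_eq y k h0 h1]
  refine (abs_convex_comb_sub_le hL hα hα1 (by linarith) (by linarith) (by linarith)
    (by linarith) hk hk1).trans ?_
  have h2 : 0 ≤ (1 - (t - k)) * (t - k) + (t - k) * (k + 1 - t) := by
    have : 0 ≤ (t - k) * (k + 1 - t) := mul_nonneg (by linarith) (by linarith)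
    nlinarith
  gcongr
  nlinarith [sq_nonneg (t - k - 1 / 2)]

/-! ### Interpolation at quadratically many points by two hidden layers. -/

/-- The positive part of `t - i`. -/
noncomputable def hinge (i t : ℝ) : ℝ := max (t - i) 0

theorem hinge_of_le {i t : ℝ} (h : t ≤ i) : hinge i t = 0 := max_eq_right (by linarith)

theorem hinge_of_ge {i t : ℝ} (h : i ≤ t) : hinge i t = t - i := max_eq_left (by linarith)

/-- The change of slope of `interp y` at the point `i`. -/
noncomputable def kink (y : ℕ → ℝ) : ℕ → ℝ
  | 0 => y 1 - y 0
  | i + 1 => y (i + 2) - 2 * y (i + 1) + y i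

/-- The sum of the first `k + 1` terms continues the `k`-th linear piece to the right, and the
hinges starting beyond `t` vanish. -/
theorem add_sum_kink_mul_hinge (y : ℕ → ℝ) (M : ℕ) {t : ℝ} (ht : 0 ≤ t) (htM : t ≤ M) :
    y 0 + ∑ i ∈ Finset.range M, kink y i * hinge i t = interp y t := by
  have h1 : ∀ k : ℕ, ∀ t : ℝ, (k : ℝ) ≤ t →
      y 0 + ∑ i ∈ Finset.range (k + 1), kink y i * hinge i t =
        (1 - (t - k)) * y k + (t - k) * y (k + 1) := by
    intro k
    induction k with
    | zero =>
      intro t ht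
      have ht' : (0 : ℝ) ≤ t := by simpa using ht
      simp [kink, hinge_of_ge ht']
      ring
    | succ k ih =>
      intro t ht
      push_cast at ht
      rw [Finset.sum_range_succ, ← add_assoc, ih t (by linarith),
        hinge_of_ge (by push_cast; exact ht), kink]
      push_cast
      ring
  rcases ht.eq_or_lt with rfl | ht0
  · rw [Finset.sum_eq_zero, add_zero]
    · simpa using (interp_natCast y 0).symm
    · intro i _
      rw [hinge_of_le (Nat.cast_nonneg i), mul_zero]
  obtain ⟨k, hk, hk1⟩ : ∃ k : ℕ, (k : ℝ) < t ∧ t ≤ k + 1 := by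
    have h := Nat.ceil_lt_add_one ht
    have h1 : 1 ≤ ⌈t⌉₊ := Nat.one_le_ceil_iff.2 ht0
    have h2 := Nat.le_ceil t
    refine ⟨⌈t⌉₊ - 1, ?_, ?_⟩ <;> push_cast [h1] <;> linarith
  have hkM : k + 1 ≤ M := by
    have : (k : ℝ) < M := hk.trans_le htM
    exact_mod_cast this
  rw [interp_eq y k hk.le hk1, ← h1 k t hk.le]
  congr 1
  refine (Finset.sum_subset (Finset.range_mono hkM) fun i _ hi => ?_).symm
  have : (k : ℝ) + 1 ≤ i := by
    rw [Finset.mem_range, not_lt] at hi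
    exact_mod_cast hi
  rw [hinge_of_le (by linarith), mul_zero]

/-- Nonnegative kinks at one position in each of the blocks `[jm, (j + 1)m]` are created, up to
functions with breakpoints at `jm` and `jm + 1`, by the positive part of one such function. -/
theorem exists_max_add_eq_sum_hinge (V : Submodule ℝ (ℝ → ℝ)) (m k : ℕ) (hk : 1 ≤ k) (hkm : k ≤ m)
    (a : ℕ → ℝ) (ha : ∀ j, 0 ≤ a j) (J : ℕ)
    (hV : ∀ j < J, hinge ((j * m : ℕ) : ℝ) ∈ V ∧ hinge ((j * m + 1 : ℕ) : ℝ) ∈ V) :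
    ∃ u ∈ V, ∃ v ∈ V,
      (∀ t, max (u t) 0 + v t = ∑ j ∈ Finset.range J, a j * hinge ((j * m + k : ℕ) : ℝ) t) ∧
      ∃ e s : ℝ, (∀ t, ((J * m : ℕ) : ℝ) ≤ t → u t = e + s * (t - (J * m : ℕ))) ∧
        (0 ≤ e ∧ 0 ≤ s ∨ e ≤ 0 ∧ s ≤ 0) := by
  induction J with
  | zero => exact ⟨0, V.zero_mem, 0, V.zero_mem, by simp, 0, 0, by simp, by simp⟩
  | succ J ih =>
    obtain ⟨u, hu, v, hv, huv, e, s, hes, hsgn⟩ := ih fun j hj => hV j (by omega)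
    obtain ⟨hb, hb'⟩ := hV J (by omega)
    have hk' : (1 : ℝ) ≤ k := by exact_mod_cast hk
    have hkm' : (k : ℝ) ≤ m := by exact_mod_cast hkm
    have haJ := ha J
    set x : ℝ := ((J * m : ℕ) : ℝ) with hx
    have hx1 : ((J * m + 1 : ℕ) : ℝ) = x + 1 := by push_cast [hx]; ring
    have hxk : ((J * m + k : ℕ) : ℝ) = x + k := by push_cast [hx]; ring
    have hxm : (((J + 1) * m : ℕ) : ℝ) = x + m := by push_cast [hx]; ring
    rw [hx1] at hb'
    rw [hxm]
    simp only [Finset.sum_range_succ, hxk]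
    rcases hsgn with ⟨he, hs⟩ | ⟨he, hs⟩
    -- The function `u` enters the block nonnegative. On `[x, x + 1]` it is steered to the value `a
    -- J * (k - 1)`, and then descends with slope `-a J` through zero at `x + k`. Its positive part
    -- gains the kink `a J` there, and `v - D` cancels the correction made to `u`.
    · set p : ℝ := a J * (k - 1) - e - s
      set q : ℝ := -a J - (s + p)
      set D : ℝ → ℝ := p • hinge x + q • hinge (x + 1) with hD
      have hDV : D ∈ V := V.add_mem (V.smul_mem _ hb) (V.smul_mem _ hb')
      have D0 : ∀ t ≤ x, D t = 0 := fun t ht => by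
        simp [hD, hinge_of_le ht, hinge_of_le (ht.trans (by linarith : x ≤ x + 1))]
      have D1 : ∀ t, x ≤ t → t ≤ x + 1 → D t = p * (t - x) := fun t h1 h2 => by
        simp [hD, hinge_of_ge h1, hinge_of_le h2]
      have D2 : ∀ t, x + 1 ≤ t → D t = p * (t - x) + q * (t - (x + 1)) := fun t h1 => by
        simp [hD, hinge_of_ge h1, hinge_of_ge (by linarith : x ≤ t)]
      refine ⟨u + D, V.add_mem hu hDV, v - D, V.sub_mem hv hDV, fun t => ?_,
        -(a J * (m - k)), -a J, fun t ht => ?_, Or.inr ⟨?_, by linarith⟩⟩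
      · rw [← huv t]
        simp only [Pi.add_apply, Pi.sub_apply]
        rcases le_total t x with h | h
        · rw [D0 t h, hinge_of_le (by linarith)]
          ring_nf
        · have hut : 0 ≤ u t := by
            rw [hes t h]
            have : 0 ≤ s * (t - x) := mul_nonneg hs (by linarith)
            linarith
          rw [max_eq_left hut]
          rcases le_total t (x + 1) with h1 | h1
          · rw [D1 t h h1, hinge_of_le (by linarith), max_eq_left]
            · ring
            · rw [hes t h]
              have h3 : 0 ≤ e * (x + 1 - t) := mul_nonneg he (by linarith)
              have h4 : 0 ≤ a J * (k - 1) * (t - x) :=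
                mul_nonneg (mul_nonneg haJ (by linarith)) (by linarith)
              simp only [p]
              nlinarith
          · have h5 : u t + D t = -(a J * (t - (x + k))) := by
              rw [D2 t h1, hes t h]
              simp only [p, q]
              ring
            rw [h5]
            rcases le_total t (x + k) with h6 | h6
            · have : 0 ≤ a J * ((x + k) - t) := mul_nonneg haJ (by linarith)
              rw [hinge_of_le h6, max_eq_left (by linarith)]
              linarith
            · have : 0 ≤ a J * (t - (x + k)) := mul_nonneg haJ (by linarith)
              rw [hinge_of_ge h6, max_eq_right (by linarith)]
              linarith
      · rw [Pi.add_apply, D2 t (by linarith), hes t (by linarith)]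
        simp only [p, q]
        ring
      · have := mul_nonneg haJ (by linarith : (0 : ℝ) ≤ m - k)
        linarith
    -- Now `u` enters nonpositive and is steered to cross zero upwards at `x + k`. The positive part
    -- vanishes before that point, so `v` needs no correction. The sign alternates from block to
    -- block.
    · set p : ℝ := -(a J * (k - 1)) - e - s
      set q : ℝ := a J - (s + p)
      set D : ℝ → ℝ := p • hinge x + q • hinge (x + 1) with hD
      have hDV : D ∈ V := V.add_mem (V.smul_mem _ hb) (V.smul_mem _ hb')
      have D0 : ∀ t ≤ x, D t = 0 := fun t ht => by
        simp [hD, hinge_of_le ht, hinge_of_le (ht.trans (by linarith : x ≤ x + 1))]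
      have D1 : ∀ t, x ≤ t → t ≤ x + 1 → D t = p * (t - x) := fun t h1 h2 => by
        simp [hD, hinge_of_ge h1, hinge_of_le h2]
      have D2 : ∀ t, x + 1 ≤ t → D t = p * (t - x) + q * (t - (x + 1)) := fun t h1 => by
        simp [hD, hinge_of_ge h1, hinge_of_ge (by linarith : x ≤ t)]
      refine ⟨u + D, V.add_mem hu hDV, v, hv, fun t => ?_,
        a J * (m - k), a J, fun t ht => ?_, Or.inl ⟨?_, haJ⟩⟩
      · rw [← huv t]
        simp only [Pi.add_apply]
        rcases le_total t x with h | h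
        · rw [D0 t h, hinge_of_le (by linarith)]
          ring_nf
        · have hut : u t ≤ 0 := by
            rw [hes t h]
            have : 0 ≤ -s * (t - x) := mul_nonneg (by linarith) (by linarith)
            linarith
          rw [max_eq_right hut]
          rcases le_total t (x + 1) with h1 | h1
          · rw [D1 t h h1, hinge_of_le (by linarith), max_eq_right]
            · ring
            · rw [hes t h]
              have h3 : 0 ≤ -e * (x + 1 - t) := mul_nonneg (by linarith) (by linarith)
              have h4 : 0 ≤ a J * (k - 1) * (t - x) :=
                mul_nonneg (mul_nonneg haJ (by linarith)) (by linarith)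
              simp only [p]
              nlinarith
          · have h5 : u t + D t = a J * (t - (x + k)) := by
              rw [D2 t h1, hes t h]
              simp only [p, q]
              ring
            rw [h5]
            rcases le_total t (x + k) with h6 | h6
            · have : 0 ≤ a J * ((x + k) - t) := mul_nonneg haJ (by linarith)
              rw [hinge_of_le h6, max_eq_right (by linarith)]
              linarith
            · have : 0 ≤ a J * (t - (x + k)) := mul_nonneg haJ (by linarith)
              rw [hinge_of_ge h6, max_eq_left (by linarith)]
              linarith
      · rw [Pi.add_apply, D2 t (by linarith), hes t (by linarith)]
        simp only [p, q]
        ring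
      · exact mul_nonneg haJ (by linarith)

theorem sum_range_mul_eq (m : ℕ) (M : ℕ) (g : ℕ → ℝ) :
    ∑ i ∈ Finset.range (M * m), g i =
      ∑ k ∈ Finset.range m, ∑ j ∈ Finset.range M, g (j * m + k) := by
  rw [Finset.sum_comm]
  induction M with
  | zero => simp
  | succ M ih => rw [Nat.succ_mul, Finset.sum_range_add, ih, Finset.sum_range_succ]

/-- The first breakpoints of the blocks `[jm, (j + 1)m]`. -/
def breakpoint {m : ℕ} (q : Fin m × Fin 2) : ℕ := q.1 * m + q.2

theorem exists_coeff_of_mem_span {m : ℕ} {u : ℝ → ℝ}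
    (hu : u ∈ Submodule.span ℝ (Set.range fun o : Option (Fin m × Fin 2) =>
      o.elim (1 : ℝ → ℝ) fun q => hinge (breakpoint q))) :
    ∃ (A : Fin m × Fin 2 → ℝ) (b : ℝ), ∀ t, u t = ∑ q, A q * hinge (breakpoint q) t + b := by
  rw [Submodule.mem_span_range_iff_exists_fun] at hu
  obtain ⟨c, rfl⟩ := hu
  refine ⟨fun q => c (some q), c none, fun t => ?_⟩
  simp [Fintype.sum_option, add_comm]

/-- Interpolation at `m ^ 2 + 1` points by a network with two hidden layers of `2m` neurons. -/
theorem exists_two_layer_interp (m : ℕ) (hm : 1 ≤ m) (y : ℕ → ℝ) :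
    ∃ (A : Fin m × Fin 2 → Fin m × Fin 2 → ℝ) (b : Fin m × Fin 2 → ℝ),
      ∀ t : ℝ, 0 ≤ t → t ≤ (m : ℝ) ^ 2 →
        ∑ p : Fin m × Fin 2, (if p.2 = 0 then 1 else -1) *
          max (∑ q, A p q * hinge (breakpoint q) t + b p) 0 = interp y t := by
  set V := Submodule.span ℝ (Set.range fun o : Option (Fin m × Fin 2) =>
      o.elim (1 : ℝ → ℝ) fun q => hinge (breakpoint q)) with hVdef
  have h1 : (1 : ℝ → ℝ) ∈ V := Submodule.subset_span ⟨none, rfl⟩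
  have hb : ∀ j < m, ∀ i < 2, hinge ((j * m + i : ℕ) : ℝ) ∈ V := fun j hj i hi =>
    Submodule.subset_span ⟨some (⟨j, hj⟩, ⟨i, hi⟩), rfl⟩
  have hV : ∀ j < m, hinge ((j * m : ℕ) : ℝ) ∈ V ∧ hinge ((j * m + 1 : ℕ) : ℝ) ∈ V :=
    fun j hj => ⟨hb j hj 0 (by omega), hb j hj 1 (by omega)⟩
  have key : ∀ k, 1 ≤ k → k ≤ m → ∃ u ∈ V, ∃ u' ∈ V, ∃ v ∈ V, ∀ t,
      max (u t) 0 - max (u' t) 0 + v t =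
        ∑ j ∈ Finset.range m, kink y (j * m + k) * hinge ((j * m + k : ℕ) : ℝ) t := by
    intro k hk hkm
    obtain ⟨u, hu, v, hv, h, -⟩ := exists_max_add_eq_sum_hinge V m k hk hkm
      (fun j => max (kink y (j * m + k)) 0) (fun _ => le_max_right _ _) m hV
    obtain ⟨u', hu', v', hv', h', -⟩ := exists_max_add_eq_sum_hinge V m k hk hkm
      (fun j => max (-kink y (j * m + k)) 0) (fun _ => le_max_right _ _) m hV
    refine ⟨u, hu, u', hu', v - v', V.sub_mem hv hv', fun t => ?_⟩
    have e : ∀ c : ℝ, c = max c 0 - max (-c) 0 := fun c => by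
      rcases le_total c 0 with h | h
      · rw [max_eq_right h, max_eq_left (by linarith)]; ring
      · rw [max_eq_left h, max_eq_right (by linarith)]; ring
    calc _ = (max (u t) 0 + v t) - (max (u' t) 0 + v' t) := by
          simp only [Pi.sub_apply]; ring
      _ = _ := by
          rw [h, h', ← Finset.sum_sub_distrib]
          refine Finset.sum_congr rfl fun j _ => ?_
          rw [← sub_mul, ← e]
  choose! u hu u' hu' v hv huv using key
  -- Everything that the first layer expresses linearly: the initial value, the kinks at block
  -- starts and all correction terms. The pair of neurons with `k = 0` transmits it as `max c 0 -
  -- max (-c) 0`; each `k` from 1 to `m - 1` has one neuron for the positive kinks and one for the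
  -- negative ones.
  set c : ℝ → ℝ := y 0 • (1 : ℝ → ℝ) +
    ∑ j ∈ Finset.range m, kink y (j * m) • hinge ((j * m : ℕ) : ℝ) +
    ∑ k ∈ Finset.Ico 1 m, v k with hc
  have hcV : c ∈ V := by
    refine V.add_mem (V.add_mem (V.smul_mem _ h1) (V.sum_mem fun j hj => V.smul_mem _ ?_))
      (V.sum_mem fun k hk => ?_)
    · exact (hV j (Finset.mem_range.1 hj)).1
    · rw [Finset.mem_Ico] at hk
      exact hv k hk.1 hk.2.le
  set U : ℕ → Fin 2 → ℝ → ℝ := fun k s =>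
    if k = 0 then (if s = 0 then c else -c) else (if s = 0 then u k else u' k) with hU
  have hUV : ∀ p : Fin m × Fin 2, U p.1 p.2 ∈ V := by
    intro p
    simp only [hU]
    have := p.1.isLt
    split_ifs
    · exact hcV
    · exact V.neg_mem hcV
    · exact hu _ (by omega) (by omega)
    · exact hu' _ (by omega) (by omega)
  choose A b hAb using fun p => exists_coeff_of_mem_span (hUV p)
  refine ⟨A, b, fun t ht ht' => ?_⟩
  simp only [← hAb]
  rw [Fintype.sum_prod_type]
  simp only [Fin.sum_univ_two, if_true, one_ne_zero, if_false, one_mul]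
  rw [Finset.sum_range (fun k => max (U k 0 t) 0 + -1 * max (U k 1 t) 0) |>.symm]
  rw [← add_sum_kink_mul_hinge y (m * m) ht (by push_cast; nlinarith), sum_range_mul_eq m m]
  have bot : ∀ g : ℕ → ℝ, ∑ k ∈ Finset.range m, g k = g 0 + ∑ k ∈ Finset.Ico 1 m, g k := fun g => by
    rw [Finset.range_eq_Ico, Finset.sum_eq_sum_Ico_succ_bot (by omega)]
  rw [bot fun k => max (U k 0 t) 0 + -1 * max (U k 1 t) 0,
    bot fun k => ∑ j ∈ Finset.range m, kink y (j * m + k) * hinge ((j * m + k : ℕ) : ℝ) t]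
  have e1 : ∑ k ∈ Finset.Ico 1 m, (max (U k 0 t) 0 + -1 * max (U k 1 t) 0) =
      ∑ k ∈ Finset.Ico 1 m,
        (∑ j ∈ Finset.range m, kink y (j * m + k) * hinge ((j * m + k : ℕ) : ℝ) t - v k t) := by
    refine Finset.sum_congr rfl fun k hk => ?_
    rw [Finset.mem_Ico] at hk
    rw [← huv k hk.1 hk.2.le]
    simp only [hU, if_neg (by omega : ¬ k = 0), if_true, one_ne_zero, if_false]
    ring
  have e2 : max (U 0 0 t) 0 + -1 * max (U 0 1 t) 0 = c t := by
    simp only [hU, if_true, one_ne_zero, if_false, Pi.neg_apply]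
    rcases le_total (c t) 0 with h | h
    · rw [max_eq_right h, max_eq_left (by linarith)]; ring
    · rw [max_eq_left h, max_eq_right (by linarith)]; ring
  rw [e1, e2, Finset.sum_sub_distrib, hc]
  simp [Finset.sum_apply]
  ring

/-! ### Networks that update registers one at a time. -/

namespace ReLUMLP

/-- A two-layer network function of one variable, made nonnegative. -/
noncomputable def memory {m : ℕ} (A : Fin m × Fin 2 → Fin m × Fin 2 → ℝ)
    (b : Fin m × Fin 2 → ℝ) (t : ℝ) : ℝ :=
  max (∑ p : Fin m × Fin 2, (if p.2 = 0 then 1 else -1) *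
    max (∑ q, A p q * hinge (breakpoint q) t + b p) 0) 0

/-- Two layers of `2m` neurons read the table and a third stores the answer. The register `σ` need
not be copied meanwhile, which explains `w + 1`. -/
theorem IsNet.update_memory {N m w D : ℕ} {H : (Fin N → ℝ) → ℝ} (hH : IsNet w D H) (hm : 1 ≤ m)
    (hw : 2 * m + N ≤ w + 1) (A : Fin m × Fin 2 → Fin m × Fin 2 → ℝ) (b : Fin m × Fin 2 → ℝ)
    (σ : Fin N) :
    IsNet w (D + 3) (fun s => H (Function.update s σ (memory A b (s σ)))) := by
  classical
  have : Nonempty (Fin N) := ⟨σ⟩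
  have : Nonempty (Fin m × Fin 2) := ⟨(⟨0, hm⟩, 0)⟩
  have hN : 1 ≤ N := Nat.one_le_of_lt σ.isLt
  have hcard : Fintype.card ((Fin m × Fin 2) ⊕ {τ : Fin N // τ ≠ σ}) ≤ w := by
    simp [Fintype.card_subtype_compl]
    omega
  have h3 : IsNet (ι := (Fin m × Fin 2) ⊕ {τ : Fin N // τ ≠ σ}) w (D + 1) (fun z =>
      H (fun τ => max (if h : τ = σ then
        ∑ p : Fin m × Fin 2, (if p.2 = 0 then 1 else -1) * z (Sum.inl p)
          else z (Sum.inr ⟨τ, h⟩)) 0)) := by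
    refine hH.layer (by simp; omega) (fun τ => ?_) (fun z _ => rfl)
    split_ifs
    · exact IsAff.sum _ fun p => (IsAff.coord _).const_mul _
    · exact IsAff.coord _
  have h2 : IsNet (ι := (Fin m × Fin 2) ⊕ {τ : Fin N // τ ≠ σ}) w (D + 2) (fun z =>
      H (fun τ => if h : τ = σ then
        max (∑ p : Fin m × Fin 2, (if p.2 = 0 then 1 else -1) *
          max (∑ q, A p q * z (Sum.inl q) + b p) 0) 0
          else z (Sum.inr ⟨τ, h⟩))) := by
    refine h3.layer hcard (L := Sum.elim (fun p z => ∑ q, A p q * z (Sum.inl q) + b p)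
      (fun τ z => z (Sum.inr τ))) ?_ (fun z hz => ?_)
    · rintro (p | τ)
      · exact (IsAff.sum _ fun q => (IsAff.coord _).const_mul _).add (IsAff.const _)
      · exact IsAff.coord _
    · congr 1
      funext τ
      split_ifs <;> simp [hz]
  refine h2.layer hcard (L := Sum.elim (fun q s => s σ - breakpoint q)
      (fun τ s => s τ)) ?_ (fun s hs => ?_)
  · rintro (p | τ)
    · exact (IsAff.coord _).sub (IsAff.const _)
    · exact IsAff.coord _
  · congr 1
    funext τ
    by_cases h : τ = σ
    · subst h
      simp [memory, hinge]
    · simp [h, hs]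

/-- The tables are read one after another, so that `N` enters the width only additively and the cost
goes into depth. -/
theorem IsNet.memories {N m w D : ℕ} {H : (Fin N → ℝ) → ℝ} (hH : IsNet w D H) (hm : 1 ≤ m)
    (hw : 2 * m + N ≤ w + 1) (A : Fin N → Fin m × Fin 2 → Fin m × Fin 2 → ℝ)
    (b : Fin N → Fin m × Fin 2 → ℝ) :
    IsNet w (D + 3 * N) (fun s => H (fun σ => memory (A σ) (b σ) (s σ))) := by
  have key : ∀ S : Finset (Fin N), IsNet w (D + 3 * S.card)
      (fun s => H (fun σ => if σ ∈ S then memory (A σ) (b σ) (s σ) else s σ)) := by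
    intro S
    induction S using Finset.induction_on with
    | empty => simpa using hH
    | insert σ S hσ ih =>
      have := ih.update_memory hm hw (A σ) (b σ) σ
      rw [Finset.card_insert_of_notMem hσ, Nat.mul_succ, ← add_assoc]
      convert this using 3
      funext τ
      by_cases h : τ = σ
      · subst h
        simp [hσ]
      · simp [h]
  simpa using key Finset.univ

/-- A network function with one hidden layer whose neurons `r : R` read the coordinates `idx r`,
made nonnegative. -/
noncomputable def shallow {R : Type} [Fintype R] {d : ℕ} (idx : R → Fin d) (g o c : R → ℝ)
    (x : Fin d → ℝ) : ℝ :=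
  max (∑ r, c r * max (g r * x (idx r) - o r) 0) 0

theorem IsNet.update_shallow {R : Type} [Fintype R] {d N w D : ℕ}
    {H : (Fin d ⊕ Fin N → ℝ) → ℝ} (hH : IsNet w D H)
    (hw : Fintype.card R + d + N ≤ w + 1) (hw' : d + N ≤ w) (idx : R → Fin d) (g o c : R → ℝ)
    (hd : 1 ≤ d) (σ : Fin N) :
    IsNet w (D + 2) (fun s =>
      H (Function.update s (Sum.inr σ) (shallow idx g o c fun i => s (Sum.inl i)))) := by
  classical
  have : Nonempty (Fin d) := ⟨⟨0, hd⟩⟩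
  have hN : 1 ≤ N := Nat.one_le_of_lt σ.isLt
  have h2 : IsNet (ι := R ⊕ Fin d ⊕ {τ : Fin N // τ ≠ σ}) w (D + 1) (fun z =>
      H (fun k => max (Sum.elim (fun i => z (Sum.inr (Sum.inl i))) (fun τ =>
        if h : τ = σ then ∑ r, c r * z (Sum.inl r) else z (Sum.inr (Sum.inr ⟨τ, h⟩))) k) 0)) := by
    refine hH.layer (by simpa using hw') ?_ (fun z _ => rfl)
    rintro (i | τ)
    · exact IsAff.coord _
    · simp only [Sum.elim_inr]
      split_ifs
      · exact IsAff.sum _ fun p => (IsAff.coord _).const_mul _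
      · exact IsAff.coord _
  refine h2.layer ?_ (ι := Fin d ⊕ Fin N) (L := Sum.elim (fun r s => g r * s (Sum.inl (idx r)) - o r)
    (Sum.elim (fun i s => s (Sum.inl i)) (fun τ s => s (Sum.inr τ)))) ?_ (fun s hs => ?_)
  · simp [Fintype.card_subtype_compl]
    omega
  · rintro (r | i | τ)
    · exact ((IsAff.coord _).const_mul _).sub (IsAff.const _)
    · exact IsAff.coord _
    · exact IsAff.coord _
  · congr 1
    funext k
    rcases k with i | τ
    · simp [hs]
    · by_cases h : τ = σ
      · subst h
        simp [shallow]
      · simp [h, hs]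

theorem IsNet.shallows {R : Type} [Fintype R] {d N w D : ℕ}
    {H : (Fin d ⊕ Fin N → ℝ) → ℝ} (hH : IsNet w D H)
    (hw : Fintype.card R + d + N ≤ w + 1) (hw' : d + N ≤ w) (idx : R → Fin d)
    (g o c : Fin N → R → ℝ) (hd : 1 ≤ d) :
    IsNet (ι := Fin d ⊕ Fin N) w (D + 2 * N) (fun s => H (Sum.elim (fun i => s (Sum.inl i)) fun σ =>
      shallow idx (g σ) (o σ) (c σ) fun i => s (Sum.inl i))) := by
  have key : ∀ S : Finset (Fin N), IsNet (ι := Fin d ⊕ Fin N) w (D + 2 * S.card)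
      (fun s => H (Sum.elim (fun i => s (Sum.inl i)) fun σ =>
        if σ ∈ S then shallow idx (g σ) (o σ) (c σ) fun i => s (Sum.inl i)
        else s (Sum.inr σ))) := by
    intro S
    induction S using Finset.induction_on with
    | empty =>
      rw [Finset.card_empty, Nat.mul_zero, add_zero]
      convert hH using 3 with s
      funext k
      rcases k with i | τ <;> simp
    | insert σ S hσ ih =>
      have := ih.update_shallow hw hw' idx (g σ) (o σ) (c σ) hd σ
      rw [Finset.card_insert_of_notMem hσ, Nat.mul_succ, ← add_assoc]
      convert this using 3
      funext k
      rcases k with i | τ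
      · simp
      · by_cases h : τ = σ
        · subst h
          simp [hσ]
        · simp [h]
  simpa using key Finset.univ

end ReLUMLP

/-! ### Insertion sort and the median. -/

/-- Insert a number into a decreasing list kept in registers. -/
noncomputable def insertReg {r : ℕ} (s : Fin r → ℝ) (x : ℝ) (i : Fin r) : ℝ :=
  max (s i) (if i.1 = 0 then x else min (s ⟨i.1 - 1, by omega⟩) x)

namespace ReLUMLP

/-- Rests on `min a b = b - max (b - a) 0` and `max a b = max (b - a) 0 + a`: one layer for the
minimum, one for the maximum, and one to add up the result. -/
theorem IsNet.insertReg {r N w D : ℕ} {H : (Fin r ⊕ Fin N → ℝ) → ℝ} (hH : IsNet w D H)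
    (hw : 2 * r + N ≤ w) (σ : Fin N) :
    IsNet w (D + 3) (fun s => H (Sum.elim
      (insertReg (fun i => s (Sum.inl i)) (s (Sum.inr σ))) fun τ => s (Sum.inr τ))) := by
  have : Nonempty (Fin N) := ⟨σ⟩
  have hcard : Fintype.card (Fin r ⊕ Fin r ⊕ Fin N) ≤ w := by
    simp
    omega
  have h3 : IsNet (ι := Fin r ⊕ Fin r ⊕ Fin N) w (D + 1) (fun z =>
      H (Sum.elim (fun i => z (Sum.inl i) + z (Sum.inr (Sum.inl i)))
        (fun τ => z (Sum.inr (Sum.inr τ))))) := by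
    refine hH.layer (by simp; omega)
      (L := Sum.elim (fun i z => z (Sum.inl i) + z (Sum.inr (Sum.inl i)))
        (fun τ z => z (Sum.inr (Sum.inr τ)))) ?_ (fun z hz => ?_)
    · rintro (i | τ)
      · exact (IsAff.coord _).add (IsAff.coord _)
      · exact IsAff.coord _
    · congr 1
      funext k
      rcases k with i | τ <;> simp [hz, add_nonneg]
  have h2 : IsNet (ι := Fin r ⊕ Fin r ⊕ Fin N) w (D + 2) (fun z =>
      H (Sum.elim (fun i => max (z (Sum.inr (Sum.inr σ)) - z (Sum.inl i)
          - z (Sum.inr (Sum.inl i))) 0 + z (Sum.inr (Sum.inl i)))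
        (fun τ => z (Sum.inr (Sum.inr τ))))) := by
    refine h3.layer hcard
      (L := Sum.elim (fun i z => z (Sum.inr (Sum.inr σ)) - z (Sum.inl i) - z (Sum.inr (Sum.inl i)))
        (fun k z => z (Sum.inr k))) ?_ (fun z hz => ?_)
    · rintro (i | τ)
      · exact ((IsAff.coord _).sub (IsAff.coord _)).sub (IsAff.coord _)
      · exact IsAff.coord _
    · congr 1
      funext k
      rcases k with i | τ <;> simp [hz]
  refine h2.layer hcard
    (L := Sum.elim (fun i s => if i.1 = 0 then 0 else
      s (Sum.inr σ) - s (Sum.inl ⟨i.1 - 1, by omega⟩)) (fun k s => s k)) ?_ (fun s hs => ?_)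
  · rintro (i | τ)
    · simp only [Sum.elim_inl]
      split_ifs
      · exact IsAff.const 0
      · exact (IsAff.coord _).sub (IsAff.coord _)
    · exact IsAff.coord _
  · congr 1
    funext k
    rcases k with i | τ
    · have e1 : ∀ a b : ℝ, max a b = max (b - a) 0 + a := fun a b => by
        rw [max_add, max_comm]; simp
      have e2 : ∀ a b : ℝ, min a b = b - max (b - a) 0 := fun a b => by
        rw [← min_sub_sub_left]; simp
      simp only [_root_.insertReg, Sum.elim_inl, Sum.elim_inr, max_eq_left (hs _)]
      rw [e1]
      split_ifs
      · simp
      · rw [e2]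
    · simp [hs]

theorem IsNet.foldl_insertReg {r N w D : ℕ} {H : (Fin r → ℝ) → ℝ}
    (hH : IsNet (ι := Fin r ⊕ Fin N) w D (fun s => H fun i => s (Sum.inl i)))
    (hw : 2 * r + N ≤ w) (l : List (Fin N)) :
    IsNet (ι := Fin r ⊕ Fin N) w (D + 3 * l.length) (fun s =>
      H ((l.map fun σ => s (Sum.inr σ)).foldl _root_.insertReg fun i => s (Sum.inl i))) := by
  induction l with
  | nil => simpa using hH
  | cons σ l ih =>
    rw [List.length_cons, Nat.mul_succ, ← add_assoc]
    exact ih.insertReg hw σ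

end ReLUMLP

/-- Order statistics are described by counting the entries above each threshold `t`, so that no
sortedness argument is needed: an insertion changes the count by at most one. -/
theorem le_foldl_insertReg_iff {r : ℕ} (l : List ℝ) {t : ℝ} (s : Fin r → ℝ) (c : ℕ)
    (h : ∀ i, t ≤ s i ↔ i.1 + 1 ≤ c) (i : Fin r) :
    t ≤ l.foldl insertReg s i ↔ i.1 + 1 ≤ c + l.countP (fun x => decide (t ≤ x)) := by
  induction l generalizing s c with
  | nil => simpa using h i
  | cons x l ih =>
    rw [List.foldl_cons, ih _ (if t ≤ x then c + 1 else c), List.countP_cons]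
    · by_cases hx : t ≤ x
      · simp only [hx, if_true, decide_true]
        omega
      · simp [hx]
    · intro i
      simp only [insertReg, le_max_iff, h]
      by_cases hi : i.1 = 0
      · simp only [hi, if_true]
        split_ifs <;> simp_all
      · simp only [hi, if_false, le_min_iff, h]
        by_cases hx : t ≤ x
        · simp only [hx, if_true, and_true]
          omega
        · simp [hx]

/-- The median of `2d + 1` nonnegative numbers. -/
noncomputable def median {d : ℕ} (v : Fin (2 * d + 1) → ℝ) : ℝ :=
  ((List.finRange (2 * d + 1)).map v).foldl (insertReg (r := d + 1)) (fun _ => 0) (Fin.last d)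

theorem le_median_iff {d : ℕ} (v : Fin (2 * d + 1) → ℝ) {t : ℝ} (ht : 0 < t) :
    t ≤ median v ↔ d + 1 ≤ (Finset.univ.filter fun σ => t ≤ v σ).card := by
  rw [median, le_foldl_insertReg_iff _ _ 0 (by simp [ht])]
  rw [zero_add, List.countP_map, List.countP_eq_length_filter, Finset.card_def, Finset.filter_val,
    Fin.univ_def, Multiset.filter_coe, Multiset.coe_card]
  rfl

theorem median_nonneg {d : ℕ} (v : Fin (2 * d + 1) → ℝ) : 0 ≤ median v := by
  have : ∀ (l : List ℝ) (s : Fin (d + 1) → ℝ), (∀ i, 0 ≤ s i) → ∀ i, 0 ≤ l.foldl insertReg s i := by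
    intro l
    induction l with
    | nil => simp
    | cons x l ih => exact fun s hs => ih _ fun i => (hs i).trans (le_max_left _ _)
  exact this _ _ (fun _ => le_rfl) _

theorem median_le_add {d : ℕ} {v u : Fin (2 * d + 1) → ℝ} {ε : ℝ} (h : ∀ σ, v σ ≤ u σ + ε)
    (hε : 0 ≤ ε) : median v ≤ median u + ε := by
  by_contra! hlt
  have h0 := median_nonneg u
  have h1 := (le_median_iff v (by linarith)).1 le_rfl
  have h2 : median v - ε ≤ median u := (le_median_iff u (by linarith)).2
    (h1.trans (Finset.card_le_card fun σ hσ => by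
      simp only [Finset.mem_filter, Finset.mem_univ, true_and] at hσ ⊢
      linarith [h σ]))
  linarith

/-- If the median were too large, `d + 1` entries would be too large, hence disjoint from the `d +
1` good ones, which is too many. It is not too small since the `d + 1` good entries are all at least
`z - E`. -/
theorem abs_median_sub_le {d : ℕ} {v : Fin (2 * d + 1) → ℝ} {z E : ℝ} (hz : 0 ≤ z)
    (hE : 0 ≤ E) (h : d + 1 ≤ (Finset.univ.filter fun σ => |z - v σ| ≤ E).card) :
    |z - median v| ≤ E := by
  rw [abs_le]
  constructor
  · by_contra! hlt
    have h1 := (le_median_iff v (by linarith : 0 < median v)).1 le_rfl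
    have h2 : Disjoint (Finset.univ.filter fun σ => |z - v σ| ≤ E)
        (Finset.univ.filter fun σ => median v ≤ v σ) := by
      rw [Finset.disjoint_filter]
      intro σ _ h3 h4
      have := (abs_le.1 h3).1
      linarith
    have h3 := Finset.card_le_univ ((Finset.univ.filter fun σ => |z - v σ| ≤ E) ∪
      (Finset.univ.filter fun σ => median v ≤ v σ))
    rw [Finset.card_union_of_disjoint h2, Fintype.card_fin] at h3
    omega
  · rcases le_or_gt (z - E) 0 with h0 | h0
    · linarith [median_nonneg v]
    · have := (le_median_iff v h0).2 (h.trans (Finset.card_le_card fun σ hσ => by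
        simp only [Finset.mem_filter, Finset.mem_univ, true_and] at hσ ⊢
        linarith [(abs_le.1 hσ).2]))
      linarith

/-! ### Staircases, cells and shifted gaps. -/

/-- Truncation to `[0, 1]`, as a difference of positive parts. -/
noncomputable def ramp (u : ℝ) : ℝ := max u 0 - max (u - 1) 0

theorem ramp_nonneg (u : ℝ) : 0 ≤ ramp u :=
  sub_nonneg.2 (max_le_max_right 0 (by linarith))

theorem ramp_of_nonpos {u : ℝ} (h : u ≤ 0) : ramp u = 0 := by
  rw [ramp, max_eq_right h, max_eq_right (by linarith), sub_zero]

theorem ramp_of_one_le {u : ℝ} (h : 1 ≤ u) : ramp u = 1 := by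
  rw [ramp, max_eq_left (by linarith), max_eq_left (by linarith)]
  ring

theorem ramp_le_one (u : ℝ) : ramp u ≤ 1 := by
  rw [ramp]
  rcases le_total u 1 with h | h
  · rw [max_eq_right (by linarith : u - 1 ≤ 0), sub_zero]
    exact max_le h zero_le_one
  · rw [max_eq_left (by linarith), max_eq_left (by linarith)]
    linarith

theorem ramp_mono {u v : ℝ} (h : u ≤ v) : ramp u ≤ ramp v := by
  rcases le_total v 0 with h0 | h0
  · rw [ramp_of_nonpos h0, ramp_of_nonpos (h.trans h0)]
  rcases le_total 1 u with h1 | h1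
  · rw [ramp_of_one_le h1, ramp_of_one_le (h1.trans h)]
  rcases le_total u 0 with h2 | h2
  · rw [ramp_of_nonpos h2]
    exact ramp_nonneg v
  rcases le_total 1 v with h3 | h3
  · rw [ramp_of_one_le h3]
    exact ramp_le_one u
  · rw [ramp, ramp, max_eq_left h2, max_eq_left h0, max_eq_right (by linarith),
      max_eq_right (by linarith)]
    linarith

/-- The ramps climb on disjoint intervals, so their sum never has slope above one. The induction
splits off the first ramp, using that `max (z - 1) 0 - max (z - c) 0` is nondecreasing. -/
theorem sum_ramp_sub_le {c : ℝ} (hc : 1 ≤ c) (M : ℕ) {z z' : ℝ} (h : z ≤ z') :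
    ∑ k ∈ Finset.range M, ramp (z' - k * c) - ∑ k ∈ Finset.range M, ramp (z - k * c) ≤
      max z' 0 - max z 0 := by
  induction M generalizing z z' with
  | zero => simpa using max_le_max_right 0 h
  | succ M ih =>
    have h1 := ih (sub_le_sub_right h c)
    have e : ∀ u : ℝ, ∑ k ∈ Finset.range (M + 1), ramp (u - k * c) =
        ∑ k ∈ Finset.range M, ramp (u - c - k * c) + ramp u := fun u => by
      rw [Finset.sum_range_succ']
      congr 1
      · exact Finset.sum_congr rfl fun k _ => by
          congr 1
          push_cast
          ring
      · simp
    rw [e, e]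
    have h2 : ramp z' + max (z' - c) 0 - (ramp z + max (z - c) 0) ≤ max z' 0 - max z 0 := by
      simp only [ramp]
      have h3 : max (z' - c) 0 - max (z - c) 0 ≤ max (z' - 1) 0 - max (z - 1) 0 := by
        rcases le_total z' c with h4 | h4
        · rw [max_eq_right (by linarith : z' - c ≤ 0), max_eq_right (by linarith : z - c ≤ 0)]
          linarith [max_le_max_right (0 : ℝ) (sub_le_sub_right h 1)]
        · rw [max_eq_left (by linarith : 0 ≤ z' - c), max_eq_left (by linarith : 0 ≤ z' - 1)]
          rcases le_total z 1 with h5 | h5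
          · rw [max_eq_right (by linarith : z - 1 ≤ 0)]
            linarith [le_max_right (z - c) 0]
          · rw [max_eq_left (by linarith : 0 ≤ z - 1)]
            linarith [le_max_left (z - c) 0]
      linarith
    linarith

/-- A continuous staircase: `M` ramps of length `γ` starting at `a + kT`. -/
noncomputable def stair (a T γ : ℝ) (M : ℕ) (t : ℝ) : ℝ :=
  ∑ k ∈ Finset.range M, ramp ((t - (a + k * T)) / γ)

theorem stair_nonneg (a T γ : ℝ) (M : ℕ) (t : ℝ) : 0 ≤ stair a T γ M t :=
  Finset.sum_nonneg fun _ _ => ramp_nonneg _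

theorem stair_le (a T γ : ℝ) (M : ℕ) (t : ℝ) : stair a T γ M t ≤ M := by
  calc _ ≤ ∑ k ∈ Finset.range M, (1 : ℝ) := Finset.sum_le_sum fun _ _ => ramp_le_one _
    _ = M := by simp

theorem abs_stair_sub_le {a T γ : ℝ} (hγ : 0 < γ) (hT : γ ≤ T) (M : ℕ) (s t : ℝ) :
    |stair a T γ M s - stair a T γ M t| ≤ |s - t| / γ := by
  wlog h : t ≤ s generalizing s t
  · rw [abs_sub_comm, abs_sub_comm s t]
    exact this t s (le_of_not_ge h)
  have hmono : stair a T γ M t ≤ stair a T γ M s :=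
    Finset.sum_le_sum fun k _ => ramp_mono (by gcongr)
  rw [abs_of_nonneg (sub_nonneg.2 hmono), abs_of_nonneg (sub_nonneg.2 h)]
  have hzz : (t - a) / γ ≤ (s - a) / γ := by gcongr
  have h1 := sum_ramp_sub_le ((one_le_div hγ).2 hT) M hzz
  have e : ∀ u : ℝ, stair a T γ M u = ∑ k ∈ Finset.range M, ramp ((u - a) / γ - k * (T / γ)) :=
    fun u => Finset.sum_congr rfl fun k _ => by
      congr 1
      ring
  rw [e, e]
  refine h1.trans ?_
  have h2 : max ((s - a) / γ) 0 - max ((t - a) / γ) 0 ≤ (s - a) / γ - (t - a) / γ := by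
    rcases le_total ((t - a) / γ) 0 with h3 | h3
    · rw [max_eq_right h3, sub_zero]
      exact max_le (by linarith) (by linarith)
    · rw [max_eq_left h3, max_eq_left (h3.trans hzz)]
  refine h2.trans (le_of_eq ?_)
  ring

theorem exists_stair_eq {a T γ : ℝ} (hγ : 0 < γ) (hT : γ ≤ T) (M : ℕ) {t : ℝ}
    (ht : ∀ k < M, ¬ (a + k * T < t ∧ t < a + k * T + γ)) :
    ∃ κ ≤ M, stair a T γ M t = κ ∧ (0 < κ → a + (κ - 1) * T + γ ≤ t) ∧
      (κ < M → t ≤ a + κ * T) := by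
  induction M with
  | zero => exact ⟨0, le_rfl, by simp [stair]⟩
  | succ M ih =>
    obtain ⟨κ, hκ, h1, h2, h3⟩ := ih fun k hk => ht k (by omega)
    rw [stair, Finset.sum_range_succ, ← stair, h1]
    rcases le_or_gt t (a + M * T) with h | h
    · refine ⟨κ, by omega, ?_, h2, fun _ => ?_⟩
      · rw [ramp_of_nonpos (div_nonpos_of_nonpos_of_nonneg (by linarith) hγ.le), add_zero]
      · rcases hκ.lt_or_eq with h4 | h4
        · exact h3 h4
        · rwa [h4]
    · have h5 : a + M * T + γ ≤ t := not_lt.1 fun h6 => ht M (by omega) ⟨h, h6⟩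
      have h6 : κ = M := by
        by_contra hne
        have hlt : κ < M := by omega
        have : (κ : ℝ) * T ≤ M * T := by
          have : (κ : ℝ) ≤ M := by exact_mod_cast hκ
          gcongr
          linarith
        linarith [h3 hlt]
      refine ⟨M + 1, le_rfl, ?_, fun _ => ?_, fun h7 => by omega⟩
      · rw [ramp_of_one_le ((one_le_div hγ).2 (by linarith)), h6]
        push_cast
        ring
      · push_cast
        linarith

/-- The midpoint of the cell with index `κ` of the grid belonging to a staircase. -/
noncomputable def cellCenter (a T γ : ℝ) (M κ : ℕ) : ℝ :=
  max 0 (min 1 (((if κ = 0 then 0 else a + (κ - 1) * T + γ) +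
    (if κ = M then 1 else a + κ * T)) / 2))

theorem cellCenter_mem (a T γ : ℝ) (M κ : ℕ) :
    0 ≤ cellCenter a T γ M κ ∧ cellCenter a T γ M κ ≤ 1 :=
  ⟨le_max_left _ _, max_le zero_le_one (min_le_left _ _)⟩

theorem exists_stair_eq_and_abs_sub_cellCenter_le {a T γ ρ : ℝ} (hγ : 0 < γ) (hT : γ ≤ T) {M : ℕ}
    (hM : 1 ≤ M) (h1 : a ≤ 2 * ρ) (h2 : T - γ ≤ 2 * ρ) (h3 : 1 - (a + (M - 1) * T + γ) ≤ 2 * ρ)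
    {t : ℝ} (ht0 : 0 ≤ t) (ht1 : t ≤ 1)
    (ht : ∀ k < M, ¬ (a + k * T < t ∧ t < a + k * T + γ)) :
    ∃ κ ≤ M, stair a T γ M t = κ ∧ |t - cellCenter a T γ M κ| ≤ ρ := by
  obtain ⟨κ, hκ, h, hlo, hhi⟩ := exists_stair_eq hγ hT M ht
  refine ⟨κ, hκ, h, ?_⟩
  rw [cellCenter]
  set lo : ℝ := if κ = 0 then 0 else a + (κ - 1) * T + γ with hlodef
  set hi : ℝ := if κ = M then 1 else a + κ * T with hhidef
  have e1 : lo ≤ t := by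
    rw [hlodef]
    split_ifs with h
    · exact ht0
    · exact hlo (by omega)
  have e2 : t ≤ hi := by
    rw [hhidef]
    split_ifs with h
    · exact ht1
    · exact hhi (by omega)
  have e3 : hi - lo ≤ 2 * ρ := by
    rw [hhidef, hlodef]
    split_ifs with h h' h'
    · omega
    · rw [h]
      exact h3
    · rw [h']
      simpa using h1
    · linarith
  rw [abs_le]
  constructor
  · have : max 0 (min 1 ((lo + hi) / 2)) ≤ t + ρ :=
      max_le (by linarith) ((min_le_right _ _).trans (by linarith))
    linarith
  · have : t - ρ ≤ max 0 (min 1 ((lo + hi) / 2)) :=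
      le_max_of_le_right (le_min (by linarith) (by linarith))
    linarith

/-- The gaps of differently shifted staircases are disjoint. -/
theorem gap_disjoint {a T γ t : ℝ} {N k k' : ℕ} {σ σ' : Fin N} (hγ : 0 < γ)
    (hT : N * γ ≤ T)
    (h : a + σ * γ + k * T < t ∧ t < a + σ * γ + k * T + γ)
    (h' : a + σ' * γ + k' * T < t ∧ t < a + σ' * γ + k' * T + γ) : σ = σ' := by
  have key : ∀ {k k' : ℕ} {σ σ' : Fin N},
      (a + σ * γ + k * T < t ∧ t < a + σ * γ + k * T + γ) →
      (a + σ' * γ + k' * T < t ∧ t < a + σ' * γ + k' * T + γ) → k ≤ k' := by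
    intro k k' σ σ' h h'
    by_contra! hlt
    have h1 : (k' : ℝ) + 1 ≤ k := by exact_mod_cast hlt
    have h2 : ((σ' : ℕ) : ℝ) + 1 ≤ N := by exact_mod_cast σ'.isLt
    have h3 : ((σ' : ℕ) + 1 : ℝ) * γ ≤ N * γ := by gcongr
    have hT0 : 0 ≤ T := by
      have : (0 : ℝ) ≤ N * γ := by positivity
      linarith
    have h4 : ((k' : ℝ) + 1) * T ≤ k * T := by gcongr
    have h5 : (0 : ℝ) ≤ (σ : ℕ) * γ := by positivity
    nlinarith [h.1, h'.2]
  obtain rfl := le_antisymm (key h h') (key h' h)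
  have key2 : ∀ {σ σ' : Fin N},
      (a + σ * γ + k * T < t ∧ t < a + σ * γ + k * T + γ) →
      (a + σ' * γ + k * T < t ∧ t < a + σ' * γ + k * T + γ) → σ ≤ σ' := by
    intro σ σ' h h'
    by_contra! hlt
    have h1 : ((σ' : ℕ) : ℝ) + 1 ≤ (σ : ℕ) := by exact_mod_cast hlt
    have h3 : ((σ' : ℕ) + 1 : ℝ) * γ ≤ (σ : ℕ) * γ := by gcongr
    nlinarith [h.1, h'.2]
  exact le_antisymm (key2 h h') (key2 h' h)

/-- Pigeonhole: sending each bad `σ` to a coordinate that spoils it is injective. -/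
theorem exists_finset_forall_not {N d : ℕ} (P : Fin N → Fin d → Prop)
    (hP : ∀ i σ σ', P σ i → P σ' i → σ = σ') :
    ∃ S : Finset (Fin N), N ≤ S.card + d ∧ ∀ σ ∈ S, ∀ i, ¬ P σ i := by
  classical
  refine ⟨Finset.univ.filter fun σ => ∀ i, ¬ P σ i, ?_, fun σ hσ => (Finset.mem_filter.1 hσ).2⟩
  have h1 := Finset.card_filter_add_card_filter_not (s := (Finset.univ : Finset (Fin N)))
    (fun σ => ∀ i, ¬ P σ i)
  rw [Finset.card_univ, Fintype.card_fin] at h1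
  have h2 : (Finset.univ.filter fun σ => ¬ ∀ i, ¬ P σ i).card ≤ d := by
    have h3 : ∀ σ : {σ : Fin N // ¬ ∀ i, ¬ P σ i}, ∃ i, P σ i := fun σ => by
      simpa using σ.2
    choose F hF using h3
    have h4 := Fintype.card_le_of_injective F fun σ σ' h =>
      Subtype.ext (hP (F σ) _ _ (hF σ) (h ▸ hF σ'))
    rwa [Fintype.card_fin, Fintype.card_subtype] at h4
  omega

theorem l1Norm_le {d : ℕ} {z : Fin d → ℝ} {ρ : Fin d → ℝ} (h : ∀ i, |z i| ≤ ρ i) :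
    l1Norm z ≤ ∑ i, ρ i := Finset.sum_le_sum fun i _ => h i

theorem l1Norm_nonneg {d : ℕ} (z : Fin d → ℝ) : 0 ≤ l1Norm z :=
  Finset.sum_nonneg fun _ _ => abs_nonneg _

theorem l1Norm_sub_le_of_mem {d : ℕ} {x y : Fin d → ℝ} (hx : x ∈ unitCube d)
    (hy : y ∈ unitCube d) : l1Norm (x - y) ≤ d := by
  have : ∀ i, |(x - y) i| ≤ 1 := fun i => by
    have h1 := hx.1 i
    have h2 := hx.2 i
    have h3 := hy.1 i
    have h4 := hy.2 i
    simp only [Pi.zero_apply, Pi.one_apply] at h1 h2 h3 h4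
    rw [Pi.sub_apply, abs_le]
    constructor <;> linarith
  simpa using l1Norm_le this

/-! ### The index of a box in mixed radix. -/

/-- The weight of digit `i` in the mixed radix system with bases `M j + 1`. -/
def radix {d : ℕ} (M : Fin d → ℕ) (i : Fin d) : ℕ :=
  ∏ j : Fin i, (M (Fin.castLE i.isLt.le j) + 1)

theorem finPiFinEquiv_eq_sum_radix {d : ℕ} {M : Fin d → ℕ} (κ : ∀ i, Fin (M i + 1)) :
    (finPiFinEquiv κ : ℕ) = ∑ i, κ i * radix M i := rfl

theorem sum_mul_radix_lt {d : ℕ} (M : Fin d → ℕ) :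
    ∑ i, M i * radix M i + 1 ≤ ∏ i, (M i + 1) := by
  have := (finPiFinEquiv fun i => Fin.last (M i)).isLt
  rw [finPiFinEquiv_eq_sum_radix] at this
  simpa using this

theorem exists_decode {d : ℕ} (M : Fin d → ℕ) :
    ∃ D : ℕ → ∀ i, Fin (M i + 1), ∀ κ : ∀ i, Fin (M i + 1), D (∑ i, κ i * radix M i) = κ := by
  have h0 : 0 < ∏ i, (M i + 1) := Finset.prod_pos fun i _ => Nat.succ_pos _
  refine ⟨fun j => finPiFinEquiv.symm ⟨j % _, Nat.mod_lt _ h0⟩, fun κ => ?_⟩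
  rw [Equiv.symm_apply_eq]
  ext
  rw [← finPiFinEquiv_eq_sum_radix]
  exact Nat.mod_eq_of_lt (finPiFinEquiv κ).isLt

/-- The index of the cell containing a point, continued to the gaps of the grid. -/
noncomputable def cellIndex {d : ℕ} (a T γ : Fin d → ℝ) (M : Fin d → ℕ) (x : Fin d → ℝ) : ℝ :=
  ∑ i, stair (a i) (T i) (γ i) (M i) (x i) * radix M i

section cellIndex

variable {d : ℕ} {a T γ : Fin d → ℝ} {M : Fin d → ℕ}

theorem cellIndex_nonneg (x : Fin d → ℝ) : 0 ≤ cellIndex a T γ M x :=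
  Finset.sum_nonneg fun _ _ => mul_nonneg (stair_nonneg _ _ _ _ _) (Nat.cast_nonneg _)

theorem cellIndex_le {m : ℕ} (hm : ∏ i, (M i + 1) ≤ m ^ 2) (x : Fin d → ℝ) :
    cellIndex a T γ M x ≤ (m : ℝ) ^ 2 := by
  have h1 : cellIndex a T γ M x ≤ ∑ i, (M i : ℝ) * radix M i :=
    Finset.sum_le_sum fun i _ => by
      gcongr
      exact stair_le _ _ _ _ _
  have h2 : ∑ i, M i * radix M i ≤ m ^ 2 := by
    have := sum_mul_radix_lt M
    omega
  refine h1.trans ?_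
  exact_mod_cast h2

theorem abs_cellIndex_sub_le {Λ : ℝ} (hγ : ∀ i, 0 < γ i) (hT : ∀ i, γ i ≤ T i)
    (hΛ : ∀ i, radix M i / γ i ≤ Λ) (x y : Fin d → ℝ) :
    |cellIndex a T γ M x - cellIndex a T γ M y| ≤ Λ * l1Norm (x - y) := by
  rw [cellIndex, cellIndex, ← Finset.sum_sub_distrib, l1Norm, Finset.mul_sum]
  refine (Finset.abs_sum_le_sum_abs _ _).trans (Finset.sum_le_sum fun i _ => ?_)
  rw [← sub_mul, abs_mul, abs_of_nonneg (Nat.cast_nonneg (radix M i) : (0 : ℝ) ≤ _)]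
  calc _ ≤ |x i - y i| / γ i * radix M i := by
        gcongr
        exact abs_stair_sub_le (hγ i) (hT i) _ _ _
    _ = radix M i / γ i * |x i - y i| := by ring
    _ ≤ _ := mul_le_mul_of_nonneg_right (hΛ i) (abs_nonneg _)

end cellIndex

theorem interp_lipschitz {y : ℕ → ℝ} {L : ℝ} (hL : 0 ≤ L) (hy : ∀ i j, |y i - y j| ≤ L) {s t : ℝ}
    (hs : 0 ≤ s) (ht : 0 ≤ t) : |interp y s - interp y t| ≤ L * |s - t| := by
  wlog h : s ≤ t generalizing s t
  · rw [abs_sub_comm, abs_sub_comm s]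
    exact this ht hs (le_of_not_ge h)
  have := interp_holder (M := ⌈t⌉₊) hL one_pos le_rfl (y := y) (fun i _ j _ => ?_) hs h
    (Nat.le_ceil t)
  · rwa [Real.rpow_one, ← abs_of_nonneg (sub_nonneg.2 h), abs_sub_comm t] at this
  · rw [Real.rpow_one]
    rcases eq_or_ne i j with rfl | hij
    · simp
    · refine (hy i j).trans (le_mul_of_one_le_right hL ?_)
      have : (1 : ℤ) ≤ |(i : ℤ) - j| := Int.one_le_abs (sub_ne_zero.2 (by exact_mod_cast hij))
      exact_mod_cast this

/-! ### The network for a general family of shifted grids. -/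

namespace ReLUMLP

/-- Networks computing the median of `2d + 1` numbers, each of which is looked up in a table at an
index depending on the input. -/
theorem exists_mlp_median_memory {d w m : ℕ} (hd : 1 ≤ d) (hm : 1 ≤ m)
    (a : Fin (2 * d + 1) → Fin d → ℝ) (T γ : Fin d → ℝ) (M : Fin d → ℕ)
    (hMw : 2 * ∑ i, M i + 3 * d ≤ w) (hmw : 2 * m + 2 * d ≤ w) (hdw : 6 * d + 3 ≤ w)
    (A : Fin (2 * d + 1) → Fin m × Fin 2 → Fin m × Fin 2 → ℝ)
    (b : Fin (2 * d + 1) → Fin m × Fin 2 → ℝ) (c : ℝ) :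
    ∃ Φ : ReLUMLP d 1, Φ.width ≤ w ∧ Φ.depth ≤ 16 * d + 11 ∧ ∀ x, Φ.fn x =
      median (fun σ => memory (A σ) (b σ) (cellIndex (a σ) T γ M fun i => max (x i) 0)) + c := by
  have : Nonempty (Fin d) := ⟨⟨0, hd⟩⟩
  have h1 : IsNet (ι := Fin (d + 1) ⊕ Fin (2 * d + 1)) w 0
      (fun s => s (Sum.inl (Fin.last d)) + c) :=
    .of_isAff w ((IsAff.coord _).add (IsAff.const c))
  have h2 := IsNet.foldl_insertReg (H := fun s : Fin (d + 1) → ℝ => s (Fin.last d) + c) h1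
    (by omega) (List.finRange (2 * d + 1))
  have h3 : IsNet (ι := Fin (2 * d + 1)) w (0 + 3 * (List.finRange (2 * d + 1)).length + 1)
      (fun s => median s + c) := by
    refine h2.layer (by simp; omega) (L := Sum.elim (fun _ _ => 0) (fun σ s => s σ)) ?_
      (fun s hs => ?_)
    · rintro (i | σ)
      · exact IsAff.const 0
      · exact IsAff.coord σ
    · simp [median, hs]
  have h4 := h3.memories hm (by omega) A b
  have h5 : IsNet (ι := Fin d ⊕ Fin (2 * d + 1)) w
      (0 + 3 * (List.finRange (2 * d + 1)).length + 1 + 3 * (2 * d + 1) + 1)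
      (fun s => median (fun σ => memory (A σ) (b σ) (s (Sum.inr σ))) + c) := by
    refine h4.layer (by simp; omega) (L := fun σ s => s (Sum.inr σ)) (fun σ => IsAff.coord _)
      (fun s hs => ?_)
    simp [hs]
  have h6 := h5.shallows (R := (Σ i, Fin (M i)) × Fin 2) (by simp; omega) (by omega)
    (fun r => r.1.1) (fun _ r => 1 / γ r.1.1)
    (fun σ r => (a σ r.1.1 + r.1.2 * T r.1.1) / γ r.1.1 + if r.2 = 0 then 0 else 1)
    (fun _ r => (if r.2 = 0 then 1 else -1) * radix M r.1.1) hd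
  -- The first hidden layer holds `max (x i) 0`, which is `x i` on the cube, and zeros as
  -- placeholders for the `2d + 1` indices.
  obtain ⟨Φ, hw, hD, h⟩ := h6.exists_mlp (d := d) (by simp; omega)
    (L := Sum.elim (fun i x => x i) (fun _ _ => 0)) (by
      rintro (i | σ)
      · exact IsAff.coord i
      · exact IsAff.const 0)
  -- Two layers per index, three per table and three per insertion, plus three transition layers: `8
  -- * (2d + 1) + 3`.
  refine ⟨Φ, hw, hD.trans (by simp; omega), fun x => ?_⟩
  rw [h]
  simp only [Sum.elim_inl, Sum.elim_inr]
  congr 2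
  funext σ
  congr 1
  rw [shallow, max_eq_left]
  all_goals
    have e : ∑ r : (Σ i, Fin (M i)) × Fin 2, (if r.2 = 0 then 1 else -1) * (radix M r.1.1 : ℝ) *
        max (1 / γ r.1.1 * max (x r.1.1) 0 - ((a σ r.1.1 + r.1.2 * T r.1.1) / γ r.1.1 +
          if r.2 = 0 then 0 else 1)) 0 =
        cellIndex (a σ) T γ M fun i => max (x i) 0 := by
      rw [Fintype.sum_prod_type, Fintype.sum_sigma, cellIndex]
      refine Finset.sum_congr rfl fun i _ => ?_
      rw [stair, Finset.sum_range, Finset.sum_mul]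
      refine Finset.sum_congr rfl fun k _ => ?_
      simp only [Fin.sum_univ_two, if_true, one_ne_zero, if_false, ramp]
      ring_nf
  · exact e
  · rw [e]
    exact cellIndex_nonneg _

/-- The conditions `h1`, `h2`, `h3` bound the first, the inner and the last cells in each direction
by `2 * ρ i`, for every shift; `hT` leaves room for `2d + 1` disjoint gaps in a period. -/
theorem exists_mlp_shifted_grids {d w m : ℕ} (hd : 1 ≤ d) (hm : 1 ≤ m)
    {a T γ ρ : Fin d → ℝ} {M : Fin d → ℕ} {Λ ν α : ℝ} {f : (Fin d → ℝ) → ℝ}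
    (hν : 0 ≤ ν) (hα : 0 < α) (hf : f ∈ Hol ν α (unitCube d))
    (ha : ∀ i, 0 ≤ a i) (hγ : ∀ i, 0 < γ i) (hT : ∀ i, (2 * d + 1) * γ i ≤ T i)
    (hM : ∀ i, 1 ≤ M i)
    (h1 : ∀ i, a i + 2 * d * γ i ≤ 2 * ρ i) (h2 : ∀ i, T i - γ i ≤ 2 * ρ i)
    (h3 : ∀ i, 1 - (a i + (M i - 1) * T i + γ i) ≤ 2 * ρ i)
    (hΛ : ∀ i, radix M i / γ i ≤ Λ) (hMm : ∏ i, (M i + 1) ≤ m ^ 2)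
    (hMw : 2 * ∑ i, M i + 3 * d ≤ w) (hmw : 2 * m + 2 * d ≤ w) (hdw : 6 * d + 3 ≤ w) :
    ∃ Φ : ReLUMLP d 1, Φ.width ≤ w ∧ Φ.depth ≤ 16 * d + 11 ∧
      (∀ x ∈ unitCube d, |f x - Φ.fn x| ≤ ν * (∑ i, ρ i) ^ α) ∧
      ∀ x y, |Φ.fn x - Φ.fn y| ≤ ν * (d : ℝ) ^ α * Λ * l1Norm (x - y) := by
  obtain ⟨D, hD⟩ := exists_decode M
  set R : ℝ := ν * (d : ℝ) ^ α with hR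
  have hR0 : 0 ≤ R := by positivity
  have hdR : ∀ x ∈ unitCube d, ∀ y ∈ unitCube d, |f x - f y| ≤ R := fun x hx y hy =>
    (hf x hx y hy).trans (mul_le_mul_of_nonneg_left (Real.rpow_le_rpow (l1Norm_nonneg _)
      (l1Norm_sub_le_of_mem hx hy) hα.le) hν)
  set a' : Fin (2 * d + 1) → Fin d → ℝ := fun σ i => a i + σ * γ i with ha'
  set p : Fin (2 * d + 1) → (∀ i, Fin (M i + 1)) → Fin d → ℝ := fun σ κ i =>
    cellCenter (a' σ i) (T i) (γ i) (M i) (κ i) with hp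
  have hpc : ∀ σ κ, p σ κ ∈ unitCube d := fun σ κ =>
    ⟨fun i => (cellCenter_mem _ _ _ _ _).1, fun i => (cellCenter_mem _ _ _ _ _).2⟩
  have h0c : (0 : Fin d → ℝ) ∈ unitCube d := ⟨le_rfl, zero_le_one⟩
  -- As `R` bounds the oscillation of `f` on the cube, this shift makes all table entries
  -- nonnegative, as the registers and the median require. The output bias `f 0 - R` undoes it.
  set y : Fin (2 * d + 1) → ℕ → ℝ := fun σ j => f (p σ (D j)) - f 0 + R with hy
  have hy0 : ∀ σ j, 0 ≤ y σ j := fun σ j => by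
    have := (abs_le.1 (hdR _ (hpc σ (D j)) 0 h0c)).1
    simp only [hy]
    linarith
  have hyy : ∀ σ i j, |y σ i - y σ j| ≤ R := fun σ i j => by
    have := hdR _ (hpc σ (D i)) _ (hpc σ (D j))
    simpa only [hy, add_sub_add_right_eq_sub, sub_sub_sub_cancel_right] using this
  choose A b hAb using fun σ => exists_two_layer_interp m hm (y σ)
  obtain ⟨Φ, hw, hdep, hΦ⟩ := exists_mlp_median_memory hd hm a' T γ M hMw hmw hdw A b (f 0 - R)
  have hmem : ∀ σ x, memory (A σ) (b σ) (cellIndex (a' σ) T γ M x) =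
      interp (y σ) (cellIndex (a' σ) T γ M x) := fun σ x => by
    rw [memory, hAb σ _ (cellIndex_nonneg x) (cellIndex_le hMm x),
      max_eq_left (interp_nonneg (hy0 σ) (cellIndex_nonneg x))]
  simp only [hmem] at hΦ
  have hγT : ∀ i, γ i ≤ T i := fun i => by
    have : 0 ≤ 2 * (d : ℝ) * γ i := by have := hγ i; positivity
    linarith [hT i]
  refine ⟨Φ, hw, hdep, fun x hx => ?_, fun x z => ?_⟩
  · have hx0 : ∀ i, 0 ≤ x i := fun i => hx.1 i
    have hx1 : ∀ i, x i ≤ 1 := fun i => hx.2 i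
    rw [hΦ]
    simp only [max_eq_left (hx0 _)]
    have hz0 : 0 ≤ f x - f 0 + R := by
      have := (abs_le.1 (hdR x hx 0 h0c)).1
      linarith
    have hρ0 : ∀ i, 0 ≤ ρ i := fun i => by
      have : 0 ≤ 2 * (d : ℝ) * γ i := by have := hγ i; positivity
      linarith [h1 i, ha i]
    obtain ⟨S, hS, hSgap⟩ := exists_finset_forall_not
      (fun (σ : Fin (2 * d + 1)) (i : Fin d) => ∃ k : ℕ,
        a i + σ * γ i + k * T i < x i ∧ x i < a i + σ * γ i + k * T i + γ i)
      (fun i σ σ' ⟨k, hk⟩ ⟨k', hk'⟩ => gap_disjoint (hγ i) (by push_cast; exact hT i) hk hk')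
    have key := abs_median_sub_le (v := fun σ => interp (y σ) (cellIndex (a' σ) T γ M x))
      (E := ν * (∑ i, ρ i) ^ α) hz0
      (mul_nonneg hν (Real.rpow_nonneg (Finset.sum_nonneg fun i _ => hρ0 i) _)) ?_
    · convert key using 2
      ring
    · refine (by omega : d + 1 ≤ S.card).trans (Finset.card_le_card fun σ hσ => ?_)
      simp only [Finset.mem_filter, Finset.mem_univ, true_and]
      have hσd : ((σ : ℕ) : ℝ) ≤ 2 * d := by
        have := σ.isLt
        exact_mod_cast (by omega : (σ : ℕ) ≤ 2 * d)
      have hcell : ∀ i, ∃ κ ≤ M i, stair (a' σ i) (T i) (γ i) (M i) (x i) = κ ∧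
          |x i - cellCenter (a' σ i) (T i) (γ i) (M i) κ| ≤ ρ i := fun i => by
        have e1 : (σ : ℕ) * γ i ≤ 2 * d * γ i := mul_le_mul_of_nonneg_right hσd (hγ i).le
        have e2 : 0 ≤ (σ : ℕ) * γ i := mul_nonneg (Nat.cast_nonneg _) (hγ i).le
        refine exists_stair_eq_and_abs_sub_cellCenter_le (hγ i) (hγT i) (hM i) ?_ (h2 i) ?_
          (hx0 i) (hx1 i) fun k _ hk => hSgap σ hσ i ⟨k, hk⟩
        · simp only [ha']
          linarith [h1 i]
        · simp only [ha']
          linarith [h3 i]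
      choose κ hκ hκ1 hκ2 using hcell
      have hI : cellIndex (a' σ) T γ M x =
          ((∑ i, (⟨κ i, Nat.lt_succ_of_le (hκ i)⟩ : Fin (M i + 1)) * radix M i : ℕ) : ℝ) := by
        simp [cellIndex, hκ1]
      rw [hI, interp_natCast]
      simp only [hy]
      rw [hD fun i => ⟨κ i, Nat.lt_succ_of_le (hκ i)⟩]
      have e := hf x hx (p σ fun i => ⟨κ i, Nat.lt_succ_of_le (hκ i)⟩) (hpc _ _)
      rw [add_sub_add_right_eq_sub, sub_sub_sub_cancel_right]
      refine e.trans (mul_le_mul_of_nonneg_left ?_ hν)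
      exact Real.rpow_le_rpow (l1Norm_nonneg _) (l1Norm_le fun i => hκ2 i) hα.le
  · rw [hΦ, hΦ, add_sub_add_right_eq_sub]
    set x' : Fin d → ℝ := fun i => max (x i) 0
    set z' : Fin d → ℝ := fun i => max (z i) 0
    have hxz : l1Norm (x' - z') ≤ l1Norm (x - z) :=
      Finset.sum_le_sum fun i _ => abs_max_sub_max_le_abs (x i) (z i) 0
    have hΛ0 : 0 ≤ Λ :=
      (div_nonneg (Nat.cast_nonneg _) (hγ ⟨0, hd⟩).le).trans (hΛ ⟨0, hd⟩)
    have key : ∀ σ, |interp (y σ) (cellIndex (a' σ) T γ M x') -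
        interp (y σ) (cellIndex (a' σ) T γ M z')| ≤ R * Λ * l1Norm (x - z) := fun σ =>
      calc _ ≤ R * |cellIndex (a' σ) T γ M x' - cellIndex (a' σ) T γ M z'| :=
            interp_lipschitz hR0 (hyy σ) (cellIndex_nonneg _) (cellIndex_nonneg _)
        _ ≤ R * (Λ * l1Norm (x' - z')) := by
            gcongr
            exact abs_cellIndex_sub_le hγ hγT hΛ x' z'
        _ ≤ R * (Λ * l1Norm (x - z)) := by gcongr
        _ = _ := by ring
    have hε : 0 ≤ R * Λ * l1Norm (x - z) := mul_nonneg (mul_nonneg hR0 hΛ0) (l1Norm_nonneg _)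
    rw [abs_le]
    constructor
    · have := median_le_add (v := fun σ => interp (y σ) (cellIndex (a' σ) T γ M z'))
        (u := fun σ => interp (y σ) (cellIndex (a' σ) T γ M x'))
        (fun σ => by linarith [(abs_le.1 (key σ)).1]) hε
      linarith
    · have := median_le_add (v := fun σ => interp (y σ) (cellIndex (a' σ) T γ M x'))
        (u := fun σ => interp (y σ) (cellIndex (a' σ) T γ M z'))
        (fun σ => by linarith [(abs_le.1 (key σ)).2]) hε
      linarith

end ReLUMLP

/-! ### The case of one variable. -/

theorem exists_nat_le_le_succ {t : ℝ} {M : ℕ} (hM : 1 ≤ M) (h0 : 0 ≤ t) (h1 : t ≤ M) :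
    ∃ k : ℕ, k + 1 ≤ M ∧ (k : ℝ) ≤ t ∧ t ≤ k + 1 := by
  rcases h1.lt_or_eq with h | h
  · exact ⟨⌊t⌋₊, (Nat.floor_lt h0).2 h, Nat.floor_le h0, (Nat.lt_floor_add_one t).le⟩
  · refine ⟨M - 1, by omega, ?_, ?_⟩ <;> push_cast [hM] <;> linarith

namespace ReLUMLP

theorem exists_mlp_interp {n : ℕ} (hn : 1 ≤ n) (y : ℕ → ℝ) :
    ∃ Φ : ReLUMLP 1 1, Φ.widthvec = [2 * n + 1, 2 * n] ∧
      ∀ x ∈ unitCube 1, Φ.fn x = interp y ((n : ℝ) ^ 2 * x 0) := by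
  have : Nonempty (Fin n × Fin 2) := ⟨(⟨0, hn⟩, 0)⟩
  obtain ⟨A, b, hAb⟩ := exists_two_layer_interp n hn y
  have h1 : Realizes (ι := Fin n × Fin 2) []
      (fun z => ∑ p : Fin n × Fin 2, (if p.2 = 0 then 1 else -1) * z p) :=
    .of_isAff (IsAff.sum _ fun p => (IsAff.coord p).const_mul _)
  -- The index `none` is an idle neuron that brings the first width from `2n` to the prescribed `2n
  -- + 1`.
  have h2 := h1.layer (ι := Option (Fin n × Fin 2)) (fun p =>
    (IsAff.sum Finset.univ fun q => (IsAff.coord (some q)).const_mul (A p q)).add (IsAff.const (b p)))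
    (fun z _ => rfl)
  obtain ⟨Φ, hw, hΦ⟩ := h2.exists_mlp (d := 1)
    (L := fun o x => o.elim 0 fun q => (n : ℝ) ^ 2 * x 0 - breakpoint q) (by
      rintro (_ | q)
      · exact IsAff.const 0
      · exact ((IsAff.coord 0).const_mul _).sub (IsAff.const _))
  refine ⟨Φ, by simpa [mul_comm] using hw, fun x hx => ?_⟩
  have h0 : 0 ≤ x 0 := hx.1 0
  have h1 : x 0 ≤ 1 := hx.2 0
  rw [hΦ, ← hAb _ (by positivity) (mul_le_of_le_one_right (by positivity) h1)]
  rfl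

theorem width_le_of_widthvec {a c w : ℕ} {Φ : ReLUMLP a c} (h : ∀ v ∈ Φ.widthvec, v ≤ w) :
    Φ.width ≤ w := foldr_max_le h

/-- Piecewise linear interpolation of a Hölder function on `[0, 1]` at `n ^ 2 + 1` points. -/
theorem exists_mlp_univariate {n : ℕ} {ν α : ℝ} {f : (Fin 1 → ℝ) → ℝ} (hn : 2 ≤ n) (hν : 0 ≤ ν)
    (hα : 0 < α) (hα1 : α ≤ 1) (hf : f ∈ Hol ν α (unitCube 1)) :
    ∃ Φ : ReLUMLP 1 1, Φ.widthvec = [2 * n + 1, 2 * n] ∧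
      (Φ.numParams : ℝ) ≤ 40000 * (n : ℝ) ^ 2 ∧
      (∀ x ∈ unitCube 1, |f x - Φ.fn x| ≤ ν / (2 * (n : ℝ) ^ 2) ^ α) ∧
      Φ.fn ∈ Hol ν α (unitCube 1) := by
  obtain ⟨Φ, hw, hΦ⟩ := exists_mlp_interp (n := n) (by omega) (fun i => f fun _ => i / (n : ℝ) ^ 2)
  have hn0 : (0 : ℝ) < (n : ℝ) ^ 2 := by positivity
  have hl1 : ∀ z : Fin 1 → ℝ, l1Norm z = |z 0| := fun z => by simp [l1Norm]
  have hL : 0 ≤ ν / ((n : ℝ) ^ 2) ^ α := by positivity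
  have hmem : ∀ i : ℕ, i ≤ n ^ 2 → (fun _ => (i : ℝ) / (n : ℝ) ^ 2) ∈ unitCube 1 := fun i hi =>
    ⟨fun _ => by simp only [Pi.zero_apply]; positivity, fun _ => by
      simp only [Pi.one_apply]
      rw [div_le_one hn0]
      exact_mod_cast hi⟩
  have hscale : ∀ u : ℝ, ν * |u / (n : ℝ) ^ 2| ^ α = ν / ((n : ℝ) ^ 2) ^ α * |u| ^ α := fun u => by
    rw [abs_div, abs_of_pos hn0, Real.div_rpow (abs_nonneg u) hn0.le]
    ring
  refine ⟨Φ, hw, ?_, fun x hx => ?_, ?_⟩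
  · have h1 := numParams_le Φ (w := 2 * n + 1) (by omega) (by omega)
      (width_le_of_widthvec (by simp [hw]))
    rw [depth, hw] at h1
    have h2 : Φ.numParams ≤ 40000 * n ^ 2 := by
      refine h1.trans ?_
      simp only [List.length_cons, List.length_nil]
      nlinarith
    exact_mod_cast h2
  · have h0 : 0 ≤ x 0 := hx.1 0
    have h1 : x 0 ≤ 1 := hx.2 0
    obtain ⟨k, hk, hk0, hk1⟩ := exists_nat_le_le_succ (t := (n : ℝ) ^ 2 * x 0) (M := n ^ 2)
      (Nat.one_le_pow _ _ (by omega)) (by positivity)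
      (by push_cast; exact mul_le_of_le_one_right hn0.le h1)
    have hnode : ∀ i : ℕ, i ≤ n ^ 2 → |f (fun _ => (i : ℝ) / (n : ℝ) ^ 2) - f x| ≤
        ν / ((n : ℝ) ^ 2) ^ α * |i - (n : ℝ) ^ 2 * x 0| ^ α := fun i hi => by
      refine (hf _ (hmem i hi) x hx).trans (le_of_eq ?_)
      rw [hl1, ← hscale, sub_div, mul_div_cancel_left₀ _ hn0.ne', Pi.sub_apply]
    have e1 := hnode k (by omega)
    have e2 := hnode (k + 1) hk
    rw [abs_sub_comm (k : ℝ), abs_of_nonneg (sub_nonneg.2 hk0)] at e1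
    rw [Nat.cast_succ, abs_of_nonneg (sub_nonneg.2 hk1)] at e2
    have := abs_interp_sub_le (y := fun i : ℕ => f fun _ => (i : ℝ) / (n : ℝ) ^ 2) hL hα.le hα1 k
      hk0 hk1 e1 (by rw [Nat.cast_succ]; exact e2)
    rw [abs_sub_comm, hΦ x hx]
    refine this.trans (le_of_eq ?_)
    rw [mul_comm (2 : ℝ), Real.mul_rpow hn0.le zero_le_two,
      Real.div_rpow zero_le_one zero_le_two, Real.one_rpow]
    field_simp
  · intro x hx z hz
    wlog h : x 0 ≤ z 0 generalizing x z
    · rw [abs_sub_comm, hl1, Pi.sub_apply, abs_sub_comm (x 0), ← Pi.sub_apply, ← hl1]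
      exact this z hz x hx (le_of_not_ge h)
    have hx0 : 0 ≤ x 0 := hx.1 0
    have hz1 : z 0 ≤ 1 := hz.2 0
    rw [hΦ x hx, hΦ z hz]
    refine (interp_holder (M := n ^ 2) (α := α) hL hα hα1 (fun i hi j hj => ?_) (by positivity)
      (by gcongr) (by push_cast; exact mul_le_of_le_one_right hn0.le hz1)).trans (le_of_eq ?_)
    · refine (hf _ (hmem i hi) _ (hmem j hj)).trans (le_of_eq ?_)
      rw [hl1, ← hscale, sub_div, Pi.sub_apply]
    · have e : (n : ℝ) ^ 2 * z 0 - (n : ℝ) ^ 2 * x 0 = |(n : ℝ) ^ 2 * (x 0 - z 0)| := by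
        rw [abs_mul, abs_of_pos hn0, abs_of_nonpos (by linarith)]
        ring
      rw [e, ← hscale, mul_div_cancel_left₀ _ hn0.ne', hl1, Pi.sub_apply]

end ReLUMLP

/-! ### The case of several variables: choice of the grid. -/

theorem sq_le_five_mul_two_pow (k : ℕ) : (k + 2) ^ 2 ≤ 5 * 2 ^ k := by
  induction k with
  | zero => norm_num
  | succ k ih =>
    rcases Nat.eq_zero_or_pos k with rfl | hk
    · norm_num
    · rw [pow_succ 2 k]
      nlinarith

theorem sq_mul_sq_le {d n : ℕ} (hd : 2 ≤ d) (hn : 2 ≤ n) : (n * d) ^ 2 ≤ 5 * n ^ d := by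
  obtain ⟨k, rfl⟩ := Nat.exists_eq_add_of_le' hd
  calc (n * (k + 2)) ^ 2 = n ^ 2 * (k + 2) ^ 2 := mul_pow _ _ _
    _ ≤ n ^ 2 * (5 * n ^ k) := by
        gcongr
        exact (sq_le_five_mul_two_pow k).trans (by gcongr)
    _ = 5 * n ^ (k + 2) := by ring

theorem optLip_le {d : ℕ} {g : (Fin d → ℝ) → ℝ} {L : ℝ} (hL : 0 ≤ L)
    (h : ∀ x y, |g x - g y| ≤ L * l1Norm (x - y)) : optLip g ≤ ENNReal.ofReal L :=
  iSup_le fun x => iSup_le fun y => iSup_le fun _ =>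
    ENNReal.ofReal_le_ofReal (div_le_of_le_mul₀ (l1Norm_nonneg _) hL (h x y))

namespace ReLUMLP

theorem exists_mlp_of_grid {d n : ℕ} (hd : 2 ≤ d) (hn : 2 ≤ n)
    {a T γ ρ : Fin d → ℝ} {M : Fin d → ℕ} {ν α : ℝ} {f : (Fin d → ℝ) → ℝ}
    (hν : 0 ≤ ν) (hα : 0 < α) (hf : f ∈ Hol ν α (unitCube d))
    (ha : ∀ i, 0 ≤ a i) (hγ : ∀ i, 0 < γ i) (hT : ∀ i, (2 * d + 1) * γ i ≤ T i)
    (hM : ∀ i, 1 ≤ M i)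
    (h1 : ∀ i, a i + 2 * d * γ i ≤ 2 * ρ i) (h2 : ∀ i, T i - γ i ≤ 2 * ρ i)
    (h3 : ∀ i, 1 - (a i + (M i - 1) * T i + γ i) ≤ 2 * ρ i)
    (hΛ : ∀ i, radix M i / γ i ≤ ((n : ℝ) + 1) ^ d * (2 * d + 1))
    (hρ : ∑ i, ρ i ≤ (d : ℝ) ^ 2 / (n * (2 * d + 1)))
    (hMn : ∑ i, M i ≤ n * d) (hN : ∏ i, (M i + 1) ≤ (n + 1) ^ d)
    (hN' : ∏ i, (M i + 1) ≤ 32 * n ^ d) :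
    ∃ Φ : ReLUMLP d 1,
      Φ.width ≤ max ((2 * n + 3) * d)
        (max (6 * d + 3) (2 * ⌈((n : ℝ) + 1) ^ ((d : ℝ) / 2)⌉₊ + 2 * d)) ∧
      Φ.depth ≤ 23 * d + 9 ∧
      (Φ.numParams : ℝ) ≤ 40000 * ((d : ℝ) * (n : ℝ) ^ d) ∧
      (∀ x ∈ unitCube d,
        |f x - Φ.fn x| ≤ ν * ((d : ℝ) ^ 2 / ((n : ℝ) * (2 * (d : ℝ) + 1))) ^ α) ∧
      optLip Φ.fn ≤
        ENNReal.ofReal (ν * ((n : ℝ) + 1) ^ d * (2 * (d : ℝ) + 1) * (d : ℝ) ^ α) := by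
  set N := ∏ i, (M i + 1) with hNdef
  have hN0 : 0 < N := Finset.prod_pos fun i _ => Nat.succ_pos _
  set m := ⌈√(N : ℝ)⌉₊ with hm
  have hm1 : 1 ≤ m := Nat.one_le_ceil_iff.2 (Real.sqrt_pos.2 (by exact_mod_cast hN0))
  have hNm : N ≤ m ^ 2 := by
    have : (N : ℝ) ≤ (m : ℝ) ^ 2 := by
      rw [← Real.sqrt_le_left (Nat.cast_nonneg m)]
      exact Nat.le_ceil _
    exact_mod_cast this
  have hmN : m ^ 2 ≤ 2 * N + 2 := by
    have h4 : (m : ℝ) < √N + 1 := Nat.ceil_lt_add_one (Real.sqrt_nonneg _)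
    have h5 := Real.sq_sqrt (Nat.cast_nonneg N : (0 : ℝ) ≤ N)
    have h6 : (m : ℝ) ^ 2 ≤ 2 * N + 2 := by
      have := Real.sqrt_nonneg (N : ℝ)
      nlinarith [sq_nonneg (√(N : ℝ) - 1)]
    exact_mod_cast h6
  have hmceil : m ≤ ⌈((n : ℝ) + 1) ^ ((d : ℝ) / 2)⌉₊ := by
    refine Nat.ceil_mono ?_
    rw [Real.sqrt_le_left (by positivity), ← Real.rpow_natCast (((n : ℝ) + 1) ^ ((d : ℝ) / 2)),
      ← Real.rpow_mul (by positivity)]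
    have : (d : ℝ) / 2 * (2 : ℕ) = d := by
      push_cast
      ring
    rw [this, Real.rpow_natCast]
    exact_mod_cast hN
  set w := max ((2 * n + 3) * d) (max (6 * d + 3) (2 * m + 2 * d)) with hw
  obtain ⟨Φ, hΦw, hΦD, herr, hlip⟩ := exists_mlp_shifted_grids (w := w) (by omega) hm1 hν hα hf ha
    hγ hT hM h1 h2 h3 hΛ hNm
    (le_max_of_le_left (by nlinarith))
    (le_max_of_le_right (le_max_right _ _))
    (le_max_of_le_right (le_max_left _ _))
  refine ⟨Φ, hΦw.trans (max_le_max le_rfl (max_le_max le_rfl (by omega))), by omega, ?_, fun x hx => (herr x hx).trans ?_, ?_⟩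
  · have hdw : d ≤ w := le_max_of_le_left (by nlinarith)
    have hnum := numParams_le Φ hdw (by omega) hΦw
    have hww : w + 1 ≤ 10 * (n * d) + 2 * m := by
      have h4 : w ≤ (2 * n + 3) * d + (6 * d + 3) + (2 * m + 2 * d) :=
        max_le (by omega) (max_le (by omega) (by omega))
      nlinarith
    have h5 : (w + 1) ^ 2 ≤ (10 * (n * d) + 2 * m) ^ 2 := Nat.pow_le_pow_left hww 2
    have h6 : (10 * (n * d) + 2 * m) ^ 2 ≤ 200 * (n * d) ^ 2 + 8 * m ^ 2 := by
      zify
      nlinarith [sq_nonneg (10 * ((n : ℤ) * d) - 2 * m)]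
    have h7 := sq_mul_sq_le hd hn
    have h8 : 1 ≤ n ^ d := Nat.one_le_pow _ _ (by omega)
    -- From `(n * d) ^ 2 ≤ 5 * n ^ d` and `m ^ 2 ≤ 2 * N + 2 ≤ 66 * n ^ d`: the constant is `200 * 5
    -- + 8 * 66`.
    have h9 : (w + 1) ^ 2 ≤ 1528 * n ^ d := by omega
    have h10 : Φ.numParams ≤ 40000 * (d * n ^ d) :=
      calc _ ≤ (Φ.depth + 1) * (w + 1) ^ 2 := hnum
        _ ≤ (22 * d) * (1528 * n ^ d) := Nat.mul_le_mul (by omega) h9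
        _ = 33616 * (d * n ^ d) := by ring
        _ ≤ _ := by gcongr; norm_num
    exact_mod_cast h10
  · have hρ0 : ∀ i, 0 ≤ ρ i := fun i => by
      have : 0 ≤ 2 * (d : ℝ) * γ i := by have := hγ i; positivity
      linarith [h1 i, ha i]
    gcongr
    exact Finset.sum_nonneg fun i _ => hρ0 i
  · refine optLip_le (by positivity) fun x y => (hlip x y).trans (le_of_eq ?_)
    ring

/-- Each direction has period `1 / n`, split into `2d + 1` gap lengths. The first cell at the
largest shift, the inner cells and the unshifted last cell all have length `2d / (n * (2d + 1))`,
which gives exactly the required error. -/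
theorem exists_mlp_of_lt {d n : ℕ} (hd : 2 ≤ d) (hn : 2 ≤ n) (hdn : (n + 1) ^ d < 32 * n ^ d)
    {ν α : ℝ} {f : (Fin d → ℝ) → ℝ}
    (hν : 0 ≤ ν) (hα : 0 < α) (hf : f ∈ Hol ν α (unitCube d)) :
    ∃ Φ : ReLUMLP d 1,
      Φ.width ≤ max ((2 * n + 3) * d)
        (max (6 * d + 3) (2 * ⌈((n : ℝ) + 1) ^ ((d : ℝ) / 2)⌉₊ + 2 * d)) ∧
      Φ.depth ≤ 23 * d + 9 ∧
      (Φ.numParams : ℝ) ≤ 40000 * ((d : ℝ) * (n : ℝ) ^ d) ∧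
      (∀ x ∈ unitCube d,
        |f x - Φ.fn x| ≤ ν * ((d : ℝ) ^ 2 / ((n : ℝ) * (2 * (d : ℝ) + 1))) ^ α) ∧
      optLip Φ.fn ≤
        ENNReal.ofReal (ν * ((n : ℝ) + 1) ^ d * (2 * (d : ℝ) + 1) * (d : ℝ) ^ α) := by
  have hn0 : (0 : ℝ) < n := by positivity
  have hd0 : (0 : ℝ) < 2 * d + 1 := by positivity
  refine exists_mlp_of_grid hd hn hν hα hf (a := fun _ => 0) (T := fun _ => 1 / n)
    (γ := fun _ => 1 / (n * (2 * d + 1))) (ρ := fun _ => d / (n * (2 * d + 1))) (M := fun _ => n)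
    (fun _ => le_rfl) (fun _ => by positivity) (fun _ => ?_) (fun _ => by omega) (fun _ => ?_)
    (fun _ => ?_) (fun _ => ?_) (fun i => ?_) ?_ ?_ ?_ ?_
  · apply le_of_eq
    field_simp
  · apply le_of_eq
    ring
  · apply le_of_eq
    field_simp
    ring
  · apply le_of_eq
    field_simp
    ring
  · have h1 : radix (fun _ : Fin d => n) i ≤ (n + 1) ^ (d - 1) := by
      simp only [radix, Finset.prod_const, Finset.card_univ, Fintype.card_fin]
      exact Nat.pow_le_pow_right (by omega) (by omega)
    have h2 : (radix (fun _ : Fin d => n) i : ℝ) * n ≤ ((n : ℝ) + 1) ^ d := by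
      have : radix (fun _ : Fin d => n) i * n ≤ (n + 1) ^ d :=
        calc _ ≤ (n + 1) ^ (d - 1) * (n + 1) := Nat.mul_le_mul h1 (by omega)
          _ = (n + 1) ^ d := by rw [← pow_succ]; congr 1; omega
      exact_mod_cast this
    calc _ = (radix (fun _ : Fin d => n) i : ℝ) * n * (2 * d + 1) := by field_simp
      _ ≤ _ := by gcongr
  · apply le_of_eq
    simp
    ring
  · simp [mul_comm]
  · simp
  · simpa using hdn.le

/-- The numbers of thresholds of the grid that is finer in the first coordinate. -/
def gridSize (n i : ℕ) : ℕ := if i = 0 then 4 * n - 1 else n - 1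

theorem prod_gridSize {n : ℕ} (hn : 1 ≤ n) (k : ℕ) :
    ∏ j : Fin (k + 1), (gridSize n j + 1) = 4 * n ^ (k + 1) := by
  rw [Fin.prod_univ_succ]
  simp only [gridSize, Fin.val_zero, if_true, Fin.val_succ, Nat.succ_ne_zero, if_false,
    Finset.prod_const, Finset.card_univ, Fintype.card_fin]
  rw [Nat.sub_add_cancel (by omega), Nat.sub_add_cancel hn]
  ring

/-- Because `(1 + 1 / n) ^ (3 * n) ≤ e ^ 3 < 27 < 32`. -/
theorem three_mul_le {d n : ℕ} (hn : 1 ≤ n) (hdn : 32 * n ^ d ≤ (n + 1) ^ d) : 3 * n ≤ d := by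
  by_contra! hlt
  have hn0 : (0 : ℝ) < n := by positivity
  have h1 : (32 : ℝ) * n ^ d ≤ ((n : ℝ) + 1) ^ d := by exact_mod_cast hdn
  have h2 : (32 : ℝ) ≤ (1 + 1 / (n : ℝ)) ^ d := by
    have : (1 + 1 / (n : ℝ)) = ((n : ℝ) + 1) / n := by field_simp
    rw [this, div_pow, le_div_iff₀ (by positivity)]
    exact h1
  have h3 : (1 + 1 / (n : ℝ)) ^ d ≤ (1 + 1 / (n : ℝ)) ^ (3 * n) :=
    pow_le_pow_right₀ (by simp) hlt.le
  have h4 : (1 + 1 / (n : ℝ)) ^ n ≤ Real.exp 1 := by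
    calc _ ≤ Real.exp (1 / n) ^ n := by
          gcongr
          linarith [Real.add_one_le_exp (1 / (n : ℝ))]
      _ = Real.exp 1 := by
          rw [← Real.exp_nat_mul]
          congr 1
          field_simp
  have h5 : (1 + 1 / (n : ℝ)) ^ (3 * n) ≤ 3 ^ 3 := by
    rw [mul_comm, pow_mul]
    have := Real.exp_one_lt_d9
    gcongr
    linarith
  linarith

theorem exists_mlp_of_le {d n : ℕ} (hd : 2 ≤ d) (hn : 2 ≤ n) (hdn : 32 * n ^ d ≤ (n + 1) ^ d)
    {ν α : ℝ} {f : (Fin d → ℝ) → ℝ}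
    (hν : 0 ≤ ν) (hα : 0 < α) (hf : f ∈ Hol ν α (unitCube d)) :
    ∃ Φ : ReLUMLP d 1,
      Φ.width ≤ max ((2 * n + 3) * d)
        (max (6 * d + 3) (2 * ⌈((n : ℝ) + 1) ^ ((d : ℝ) / 2)⌉₊ + 2 * d)) ∧
      Φ.depth ≤ 23 * d + 9 ∧
      (Φ.numParams : ℝ) ≤ 40000 * ((d : ℝ) * (n : ℝ) ^ d) ∧
      (∀ x ∈ unitCube d,
        |f x - Φ.fn x| ≤ ν * ((d : ℝ) ^ 2 / ((n : ℝ) * (2 * (d : ℝ) + 1))) ^ α) ∧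
      optLip Φ.fn ≤
        ENNReal.ofReal (ν * ((n : ℝ) + 1) ^ d * (2 * (d : ℝ) + 1) * (d : ℝ) ^ α) := by
  have h3n := three_mul_le (by omega) hdn
  obtain ⟨e, rfl⟩ := Nat.exists_eq_add_of_le' (by omega : 1 ≤ d)
  have hn0 : (0 : ℝ) < n := by positivity
  have hn1 : (1 : ℝ) ≤ n := by exact_mod_cast (by omega : 1 ≤ n)
  set δ : ℝ := 2 * ((e + 1 : ℕ) : ℝ) + 1 with hδ
  have hd0 : 0 < δ := by positivity
  set T : Fin (e + 1) → ℝ := fun i => if i.1 = 0 then 1 / (4 * n) else 1 / n with hTdef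
  -- The gap lengths are `S i / δ`. The radix grows like `n ^ i` with `n ≥ 2`, so later coordinates
  -- need longer gaps, while doubling keeps the sum of all `S i` below `1 / (4 * n)`. The worst
  -- slope is then `32 * n ^ d * δ`, which is where the threshold 32 comes from.
  set S : Fin (e + 1) → ℝ := fun i => 2 ^ i.1 / (2 ^ (e + 1) * (4 * n)) with hSdef
  have hS0 : ∀ i, 0 < S i := fun i => by positivity
  have hST : ∀ i, S i ≤ T i := fun i => by
    have h1 : S i ≤ 1 / (4 * n) := by
      have : (2 : ℝ) ^ i.1 ≤ 2 ^ (e + 1) := pow_le_pow_right₀ one_le_two i.isLt.le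
      calc S i ≤ 2 ^ (e + 1) / (2 ^ (e + 1) * (4 * n)) := by
            simp only [hSdef]
            gcongr
        _ = 1 / (4 * n) := by field_simp
    simp only [hTdef]
    split_ifs
    · exact h1
    · refine h1.trans ?_
      gcongr
      linarith
  have hMT : ∀ i : Fin (e + 1), (gridSize n i : ℝ) * T i = 1 - T i := fun i => by
    simp only [hTdef, gridSize]
    split_ifs
    · rw [Nat.cast_sub (by omega)]
      push_cast
      field_simp
    · rw [Nat.cast_sub (by omega)]
      push_cast
      field_simp
  have hradix : ∀ i : Fin (e + 1), radix (fun j : Fin (e + 1) => gridSize n j) i ≤ 4 * n ^ i.1 := by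
    rintro ⟨k, hk⟩
    simp only [radix, Fin.val_castLE]
    cases k with
    | zero => simp
    | succ k => exact (prod_gridSize (by omega) k).le
  have hsum : ∑ i, S i ≤ 1 / (4 * n) := by
    have : ∑ i, S i = (2 ^ (e + 1) - 1) / (2 ^ (e + 1) * (4 * n)) := by
      simp only [hSdef]
      rw [← Finset.sum_div, Fin.sum_univ_eq_sum_range (fun i => (2 : ℝ) ^ i),
        geom_sum_eq (by norm_num)]
      norm_num
    rw [this]
    calc _ ≤ (2 : ℝ) ^ (e + 1) / (2 ^ (e + 1) * (4 * n)) := by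
          gcongr
          linarith
      _ = _ := by field_simp
  have hdγ : ∀ i, ((e + 1 : ℕ) : ℝ) * (S i / δ) ≤ S i / 2 := fun i => by
    rw [← mul_div_assoc, div_le_div_iff₀ hd0 two_pos]
    nlinarith [hS0 i]
  refine exists_mlp_of_grid hd hn hν hα hf (a := T) (T := T)
    (γ := fun i => S i / δ) (ρ := fun i => T i / 2 + ((e + 1 : ℕ) : ℝ) * (S i / δ))
    (M := fun i => gridSize n i)
    (fun i => (hS0 i).le.trans (hST i)) (fun i => div_pos (hS0 i) hd0) (fun i => ?_) (fun i => ?_)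
    (fun i => ?_) (fun i => ?_) (fun i => ?_) (fun i => ?_) ?_ ?_ ?_ ?_
  · rw [mul_div_cancel₀ _ hd0.ne']
    exact hST i
  · simp only [gridSize]
    split_ifs <;> omega
  · apply le_of_eq
    ring
  · have h1 := div_pos (hS0 i) hd0
    have h2 : 0 ≤ ((e + 1 : ℕ) : ℝ) * (S i / δ) := by positivity
    linarith
  · have h1 := div_pos (hS0 i) hd0
    have h2 : 0 ≤ ((e + 1 : ℕ) : ℝ) * (S i / δ) := by positivity
    have h3 := hMT i
    linarith
  · have h1 : (radix (fun j : Fin (e + 1) => gridSize n j) i : ℝ) ≤ 4 * n ^ i.1 := by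
      exact_mod_cast hradix i
    have h2 : (2 : ℝ) ^ (e - i.1) ≤ n ^ (e - i.1) := by
      gcongr
      exact_mod_cast hn
    have h3 : (32 : ℝ) * n ^ (e + 1) ≤ ((n : ℝ) + 1) ^ (e + 1) := by exact_mod_cast hdn
    have hi : i.1 + (e - i.1) = e := by omega
    have e1 : (2 : ℝ) ^ (e + 1) = 2 * (2 ^ i.1 * 2 ^ (e - i.1)) := by
      rw [← pow_add, hi, pow_succ]
      ring
    have e2 : (n : ℝ) ^ (e + 1) = n * (n ^ i.1 * n ^ (e - i.1)) := by
      rw [← pow_add, hi, pow_succ]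
      ring
    calc _ ≤ 4 * (n : ℝ) ^ i.1 / (S i / δ) := by
          have := hS0 i
          gcongr
      _ = 32 * (n * (n ^ i.1 * 2 ^ (e - i.1))) * δ := by
          simp only [hSdef]
          rw [e1]
          field_simp
          ring
      _ ≤ 32 * (n * (n ^ i.1 * n ^ (e - i.1))) * δ := by gcongr
      _ ≤ _ := by
          rw [← e2]
          gcongr
  · have h1 : ∑ i, T i = 1 / (4 * n) + e * (1 / n) := by
      rw [Fin.sum_univ_succ]
      simp [hTdef]
    rw [Finset.sum_add_distrib, ← Finset.sum_div, ← Finset.mul_sum, ← Finset.sum_div, h1]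
    have h2 : ((e + 1 : ℕ) : ℝ) * ((∑ i, S i) / δ) ≤ ((e + 1 : ℕ) : ℝ) * (1 / (4 * n) / δ) := by
      gcongr
    refine (add_le_add_right h2 _).trans ?_
    have h4 : (1 / (4 * n) + e * (1 / n)) / 2 + ((e + 1 : ℕ) : ℝ) * (1 / (4 * n) / δ) =
        ((1 + 4 * e) * δ + 2 * (e + 1)) / (8 * (n * δ)) := by
      push_cast
      field_simp
      ring
    have h5 : ((e + 1 : ℕ) : ℝ) ^ 2 / (n * δ) = 8 * ((e : ℝ) + 1) ^ 2 / (8 * (n * δ)) := by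
      push_cast
      field_simp
    rw [h4, h5]
    gcongr
    rw [hδ]
    push_cast
    nlinarith
  · rw [Fin.sum_univ_succ]
    simp only [gridSize, Fin.val_zero, if_true, Fin.val_succ, Nat.succ_ne_zero, if_false,
      Finset.sum_const, Finset.card_univ, Fintype.card_fin, smul_eq_mul]
    obtain ⟨c, rfl⟩ := Nat.exists_eq_add_of_le' (by omega : 1 ≤ n)
    simp only [Nat.add_sub_cancel]
    have : 4 * (c + 1) - 1 = 4 * c + 3 := by omega
    rw [this]
    -- The `3 * n` additional thresholds in the first coordinate are compensated by having one fewer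
    -- than `n` in each of the `d` directions, as `3 * n ≤ d`.
    nlinarith
  · rw [prod_gridSize (by omega)]
    omega
  · rw [prod_gridSize (by omega)]
    omega

end ReLUMLP

theorem mainTheorem10 :
    ∃ C : ℝ, ∀ (d n : ℕ) (ν α : ℝ) (f : (Fin d → ℝ) → ℝ),
      2 ≤ n → 0 ≤ ν → 0 < α → α ≤ 1 → f ∈ Hol ν α (unitCube d) →
      (d = 1 →
        ∃ Φ : ReLUMLP d 1,
          Φ.widthvec = [2 * n + 1, 2 * n] ∧
          (Φ.numParams : ℝ) ≤ C * (n : ℝ) ^ 2 ∧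
          (∀ x ∈ unitCube d, |f x - Φ.fn x| ≤ ν / (2 * (n : ℝ) ^ 2) ^ α) ∧
          Φ.fn ∈ Hol ν α (unitCube d)) ∧
      (1 < d →
        ∃ Φ : ReLUMLP d 1,
          Φ.width ≤ max ((2 * n + 3) * d)
            (max (6 * d + 3) (2 * ⌈((n : ℝ) + 1) ^ ((d : ℝ) / 2)⌉₊ + 2 * d)) ∧
          Φ.depth ≤ 23 * d + 9 ∧
          (Φ.numParams : ℝ) ≤ C * ((d : ℝ) * (n : ℝ) ^ d) ∧
          (∀ x ∈ unitCube d,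
            |f x - Φ.fn x| ≤ ν * ((d : ℝ) ^ 2 / ((n : ℝ) * (2 * (d : ℝ) + 1))) ^ α) ∧
          optLip Φ.fn ≤
            ENNReal.ofReal (ν * ((n : ℝ) + 1) ^ d * (2 * (d : ℝ) + 1) * (d : ℝ) ^ α)) := by
  refine ⟨40000, fun d n ν α f hn hν hα hα1 hf => ⟨?_, fun hd => ?_⟩⟩
  · rintro rfl
    exact ReLUMLP.exists_mlp_univariate hn hν hα hα1 hf
  · rcases lt_or_ge ((n + 1) ^ d) (32 * n ^ d) with h | h
    · exact ReLUMLP.exists_mlp_of_lt hd hn h hν hα hf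
    · exact ReLUMLP.exists_mlp_of_le hd hn h hν hα hf
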